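/- Let $\mathcal P_o^2$ be the set of polytopes in $\mathbb R^2$ (convex hulls of finitely many points) that contain the origin $o$. A function $Z:\mathcal P_o^2\to\mathbb R^2$ is a valuation if $Z(P)+Z(Q)=Z(P\cup Q)+Z(P\cap Q)$ whenever $P,Q,P\cup Q,P\cap Q\in\mathcal P_o^2$, and it is $\mathrm{SL}(2)$ contravariant if $Z(\phi P)=\phi^{-t}Z(P)$ for all $P\in\mathcal P_o^2$ and $\phi\in\mathrm{SL}(2)$. For $P\in\mathcal P_o^2$ and a unit vector $u$ let $h_P(u)=\max_{x\in P}\langle x,u\rangle$ and $F(P,u)=\{x\in P:\langle x,u\rangle=h_P(u)\}$. Let $\mathcal N(P)$ be the set of outer unit normals of facets of $P$ (the unit vectors $u$ with $\dim F(P,u)=1$), $\mathcal N_o(P)$ the set of those $u\in\mathcal N(P)$ for which the affine hull of $F(P,u)$ contains $o$, and $V(P,u)$ the area of the convex hull of $o$ and $F(P,u)$. For a solution $\zeta:[0,\infty)\to\mathbb R$ of Cauchy's functional equation $\zeta(x+y)=\zeta(x)+\zeta(y)$ put $$\mathrm{fv}_\zeta(P)=\sum_{u\in\mathcal N(P)\setminus\mathcal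 N_o(P)}\frac{\zeta(V(P,u))}{|h_P(u)|}\,u .$$ Let $m(P)=\int_P x\,dx$ be the moment vector of $P$. Let $e(P)=v+w$ if $\dim P=2$ and $P$ has two edges $[o,v]$ and $[o,w]$, or if $\dim P=2$ and $P$ has an edge $[v,w]$ that contains $o$ in its relative interior; $e(P)=2(v+w)$ if $\dim P=1$ and $P=[v,w]$; and $e(P)=0$ otherwise. Let $\rho_{\pi/2}$ be the counter-clockwise rotation of $\mathbb R^2$ by the angle $\pi/2$. **Theorem.** A function $Z:\mathcal P_o^2\to\mathbb R^2$ is an $\mathrm{SL}(2)$ contravariant valuation if and only if there exist constants $c_1,c_2\in\mathbb R$ and a solution $\zeta:[0,\infty)\to\mathbb R$ of Cauchy's functional equation such that $$Z(P)=\mathrm{fv}_\zeta(P)+c_1\,\rho_{\pi/2}\,m(P)+c_2\,\rho_{\pi/2}\,e(P)$$ for every $P\in\mathcal P_o^2$. -/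

import Mathlib

open scoped NNReal

noncomputable section

namespace PlanarValuation

/-- Euclidean `n`-space. -/
abbrev E (n : ℕ) : Type := EuclideanSpace ℝ (Fin n)

/-- A polytope is the convex hull of finitely many points. -/
def IsPolytope {n : ℕ} (P : Set (E n)) : Prop :=
  ∃ S : Finset (E n), P = convexHull ℝ (S : Set (E n))

/-- The space of polytopes in `ℝⁿ` that contain the origin. -/
def PolyO (n : ℕ) : Type := {P : Set (E n) // IsPolytope P ∧ (0 : E n) ∈ P}

/-- The linear action of a matrix on `ℝⁿ`. -/
def act {n : ℕ} (A : Matrix (Fin n) (Fin n) ℝ) : E n →ₗ[ℝ] E n := Matrix.toEuclideanLin A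

/-- The image `φ P` of a polytope containing the origin under `φ ∈ SL(n)`. -/
def PolyO.map {n : ℕ} (φ : Matrix.SpecialLinearGroup (Fin n) ℝ) (P : PolyO n) : PolyO n :=
  ⟨act (φ : Matrix (Fin n) (Fin n) ℝ) '' P.1, by
    classical
    obtain ⟨⟨S, hS⟩, h0⟩ := P.2
    refine ⟨⟨S.image (act (φ : Matrix (Fin n) (Fin n) ℝ)), ?_⟩, ⟨0, h0, map_zero _⟩⟩
    rw [hS, LinearMap.image_convexHull, Finset.coe_image]⟩

/-- `Z` is a valuation: `Z(P) + Z(Q) = Z(P ∪ Q) + Z(P ∩ Q)` whenever `P`, `Q`, `P ∪ Q`, `P ∩ Q`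
all belong to the space of polytopes containing the origin. -/
def IsValuation {n : ℕ} (Z : PolyO n → E n) : Prop :=
  ∀ P Q U I : PolyO n, U.1 = P.1 ∪ Q.1 → I.1 = P.1 ∩ Q.1 → Z P + Z Q = Z U + Z I

/-- `Z(φ P) = φ⁻ᵗ Z(P)` for all `φ ∈ SL(n)`. -/
def IsSLContravariant {n : ℕ} (Z : PolyO n → E n) : Prop :=
  ∀ (φ : Matrix.SpecialLinearGroup (Fin n) ℝ) (P : PolyO n),
    Z (P.map φ) = act (((φ : Matrix (Fin n) (Fin n) ℝ)⁻¹).transpose) (Z P)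

/-- Solutions `ζ : [0,∞) → ℝ` of Cauchy's functional equation. -/
def IsCauchySolution (ζ : ℝ≥0 → ℝ) : Prop := ∀ x y : ℝ≥0, ζ (x + y) = ζ x + ζ y

/-- The dimension of (the affine hull of) a nonempty set. -/
def dim {n : ℕ} (P : Set (E n)) : ℕ := Module.finrank ℝ (vectorSpan ℝ P)

/-- The support function `h_P(u) = max {⟨x, u⟩ : x ∈ P}`. -/
def supportFn {n : ℕ} (P : Set (E n)) (u : E n) : ℝ := sSup ((fun x => inner ℝ x u) '' P)

/-- `F(P,u)`: the points of `P` in the supporting hyperplane with outer normal `u`. -/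
def face {n : ℕ} (P : Set (E n)) (u : E n) : Set (E n) :=
  {x | x ∈ P ∧ inner ℝ x u = supportFn P u}

/-- The set of outer unit normals of facets of `P`, i.e. of `(n-1)`-dimensional faces. -/
def normals {n : ℕ} (P : Set (E n)) : Set (E n) :=
  {u | ‖u‖ = 1 ∧ (face P u).Nonempty ∧ dim (face P u) + 1 = n}

/-- The set of outer unit normals of facets of `P` whose affine hull contains the origin. -/
def normalsO {n : ℕ} (P : Set (E n)) : Set (E n) :=
  {u | u ∈ normals P ∧ (0 : E n) ∈ affineSpan ℝ (face P u)}

/-- `V(P,u)`: the volume of the cone `conv {o, F(P,u)}`. -/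
def coneVolume {n : ℕ} (P : Set (E n)) (u : E n) : ℝ≥0 :=
  (MeasureTheory.volume (convexHull ℝ (insert 0 (face P u)))).toNNReal

/-- The facet vector of `P` associated with `ζ`. The sum is finite by `normals_finite`. -/
def facetVector {n : ℕ} (ζ : ℝ≥0 → ℝ) (P : Set (E n)) : E n :=
  ∑ᶠ u ∈ normals P \ normalsO P, (ζ (coneVolume P u) / |supportFn P u|) • u

/-- The moment vector `∫_P x dx`. -/
def momentVector {n : ℕ} (P : Set (E n)) : E n := ∫ x in P, x

/-- The counter-clockwise rotation of the plane by the angle `θ`. -/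
def rot (θ : ℝ) : E 2 →ₗ[ℝ] E 2 :=
  act !![Real.cos θ, -Real.sin θ; Real.sin θ, Real.cos θ]

/-- `conv {v, w}` is an edge (a one-dimensional face) of `P`. -/
def IsEdge {n : ℕ} (P : Set (E n)) (v w : E n) : Prop :=
  v ≠ w ∧ IsExtreme ℝ P (segment ℝ v w)

/-- The nonzero cases in the definition of the vector `e(P)`: in each of them `x` is its value. -/
def IsEValue (P : Set (E 2)) (x : E 2) : Prop :=
  (dim P = 2 ∧ ∃ v w, v ≠ w ∧ IsEdge P 0 v ∧ IsEdge P 0 w ∧ x = v + w) ∨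
  (dim P = 2 ∧ ∃ v w, IsEdge P v w ∧ 0 ∈ openSegment ℝ v w ∧ x = v + w) ∨
  (dim P = 1 ∧ ∃ v w, P = segment ℝ v w ∧ 0 ∈ P ∧ x = (2 : ℝ) • (v + w))

open Classical in
/-- The vector `e(P)`; well defined by `IsEValue.unique`. -/
def eVector (P : Set (E 2)) : E 2 := if h : ∃ x, IsEValue P x then h.choose else 0

/-! ### The sum in the facet vector is finite -/

theorem normals_finite {n : ℕ} (P : Set (E n)) (hP : IsPolytope P) : (normals P).Finite := by
  obtain ⟨S, rfl⟩ := hP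
  set P := convexHull ℝ (S : Set (E n)) with hPdef
  have hcomp : IsCompact P := S.finite_toSet.isCompact_convexHull ℝ
  have hconv : Convex ℝ P := convex_convexHull ℝ _
  have hle : ∀ u, ∀ x ∈ P, inner ℝ x u ≤ supportFn P u := by
    intro u x hx
    refine le_csSup ?_ ⟨x, hx, rfl⟩
    exact (hcomp.image (by fun_prop : Continuous fun x : E n => inner ℝ x u)).bddAbove
  have hext : ∀ u, IsExtreme ℝ P (face P u) := by
    intro u
    refine ⟨fun x hx => hx.1, ?_⟩
    rintro x hx y hy z ⟨-, hz⟩ ⟨a, b, ha, hb, hab, rfl⟩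
    refine ⟨hx, ?_⟩
    have h1 := hle u x hx
    have h2 := hle u y hy
    rw [inner_add_left, real_inner_smul_left, real_inner_smul_left] at hz
    refine le_antisymm h1 ?_
    have hb' : b = 1 - a := by linarith
    subst hb'
    nlinarith
  have hfc : ∀ u, IsCompact (face P u) := by
    intro u
    exact hcomp.inter_right
      (isClosed_eq (by fun_prop : Continuous fun x : E n => (inner ℝ x u : ℝ)) continuous_const)
  have hfconv : ∀ u, Convex ℝ (face P u) := by
    intro u x hx y hy a b ha hb hab
    refine ⟨hconv hx.1 hy.1 ha hb hab, ?_⟩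
    rw [inner_add_left, real_inner_smul_left, real_inner_smul_left, hx.2, hy.2, ← add_mul, hab,
      one_mul]
  have hfin : ((face P) '' (normals P)).Finite := by
    have hsub : (face P) '' (normals P) ⊆
        (fun T => closure (convexHull ℝ T)) '' (𝒫 (S : Set (E n))) := by
      rintro _ ⟨u, -, rfl⟩
      refine ⟨(face P u).extremePoints ℝ, ?_,
        closure_convexHull_extremePoints (hfc u) (hfconv u)⟩
      exact (hext u).extremePoints_subset_extremePoints.trans extremePoints_convexHull_subset
    exact (S.finite_toSet.finite_subsets.image _).subset hsub
  refine Set.Finite.of_finite_fibers (face P) hfin ?_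
  rintro _ ⟨u, hu, rfl⟩
  have hperp : ∀ w, face P w = face P u → w ∈ (vectorSpan ℝ (face P u))ᗮ := by
    intro w hw
    rw [← hw, Submodule.mem_orthogonal]
    intro d hd
    refine Submodule.span_induction ?_ (by simp) ?_ ?_ hd
    · rintro _ ⟨x, hx, y, hy, rfl⟩
      simp only [vsub_eq_sub, inner_sub_left, hx.2, hy.2, sub_self]
    · intro x y _ _ hx hy
      rw [inner_add_left, hx, hy, add_zero]
    · intro a x _ hx
      rw [real_inner_smul_left, hx, mul_zero]
  have hrank : Module.finrank ℝ (vectorSpan ℝ (face P u))ᗮ = 1 := by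
    have h1 := Submodule.finrank_add_finrank_orthogonal (vectorSpan ℝ (face P u))
    have h2 := hu.2.2
    rw [finrank_euclideanSpace_fin] at h1
    unfold dim at h2
    omega
  refine (Set.toFinite {u, -u}).subset ?_
  rintro w ⟨hw, hwu⟩
  have hu0 : (⟨u, hperp u rfl⟩ : (vectorSpan ℝ (face P u))ᗮ) ≠ 0 := by
    intro h
    have : u = 0 := congrArg Subtype.val h
    have h1 := hu.1
    simp [this] at h1
  obtain ⟨c, hc⟩ := (finrank_eq_one_iff_of_nonzero' _ hu0).1 hrank ⟨w, hperp w hwu⟩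
  have hc' : c • u = w := congrArg Subtype.val hc
  have hn := hw.1
  rw [← hc', norm_smul, hu.1, mul_one, Real.norm_eq_abs] at hn
  rcases (abs_eq zero_le_one).1 hn with h | h
  · left; rw [← hc', h, one_smul]
  · right; rw [← hc', h, neg_one_smul]; rfl

/-! ### The vector `e(P)` is well defined -/

theorem IsEdge.eq_of_smul {n : ℕ} {P : Set (E n)} {u v : E n} (hu : IsEdge P 0 u)
    (hv : IsEdge P 0 v) {s : ℝ} (hs : 0 ≤ s) (h : v = s • u) : v = u := by
  have key : ∀ (x y : E n) (t : ℝ), IsEdge P 0 x → IsEdge P 0 y → 0 < t → t < 1 →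
      y ≠ t • x := by
    rintro x y t hx hy ht0 ht1 rfl
    have hxP : x ∈ P := hx.2.1 (right_mem_segment ℝ 0 x)
    have h0P : (0 : E n) ∈ P := hx.2.1 (left_mem_segment ℝ 0 x)
    have hm : x ∈ segment ℝ 0 (t • x) :=
      hy.2.right_mem_of_mem_openSegment h0P hxP (right_mem_segment ℝ 0 (t • x))
        ⟨1 - t, t, by linarith, ht0, by ring, by simp⟩
    obtain ⟨a, b, ha, hb, hab, hh⟩ := hm
    rw [smul_zero, zero_add, smul_smul] at hh
    have h1 : (b * t - 1) • x = 0 := by rw [sub_smul, hh, one_smul, sub_self]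
    rcases smul_eq_zero.1 h1 with h2 | h2
    · nlinarith
    · exact hx.1 h2.symm
  rcases hs.eq_or_lt with h0 | h0
  · subst h0
    exact absurd (by rw [h, zero_smul]) hv.1
  rcases lt_trichotomy s 1 with h1 | h1 | h1
  · exact absurd h (key u v s hu hv h0 h1)
  · rw [h, h1, one_smul]
  · refine absurd ?_ (key v u s⁻¹ hv hu (inv_pos.2 h0) (inv_lt_one_of_one_lt₀ h1))
    rw [h, smul_smul, inv_mul_cancel₀ h0.ne', one_smul]

theorem IsEdge.ray {n : ℕ} {P : Set (E n)} (hP : Convex ℝ P) {u x y : E n}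
    (hu : IsEdge P 0 u) (hx : x ∈ P) (hy : y ∈ P) {a b c : ℝ} (ha : 0 < a) (hb : 0 ≤ b)
    (hc : 0 ≤ c) (h : a • x + b • y = c • u) : ∃ s : ℝ, 0 ≤ s ∧ x = s • u := by
  rcases hb.eq_or_lt with hb0 | hb0
  · subst hb0
    refine ⟨a⁻¹ * c, by positivity, ?_⟩
    rw [mul_smul, ← h, zero_smul, add_zero, smul_smul, inv_mul_cancel₀ ha.ne', one_smul]
  have h0P : (0 : E n) ∈ P := hu.2.1 (left_mem_segment ℝ 0 u)
  set ε : ℝ := (a + b) / (a + b + c) with hε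
  have hs : 0 < a + b + c := by positivity
  have hε0 : 0 < ε := by positivity
  have hε1 : ε ≤ 1 := by rw [hε, div_le_one hs]; linarith
  have hsc : ∀ z ∈ P, ε • z ∈ P := fun z hz => hP.smul_mem_of_zero_mem h0P hz ⟨hε0.le, hε1⟩
  have hmem : (c / (a + b + c)) • u ∈ segment ℝ 0 u := by
    refine ⟨1 - c / (a + b + c), c / (a + b + c), ?_, by positivity, by ring, by simp⟩
    rw [sub_nonneg, div_le_one hs]; linarith
  have hop : (c / (a + b + c)) • u ∈ openSegment ℝ (ε • x) (ε • y) := by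
    refine ⟨a / (a + b), b / (a + b), by positivity, by positivity, by field_simp, ?_⟩
    have hab : 0 < a + b := by positivity
    have e1 : a / (a + b) * ε = (a + b + c)⁻¹ * a := by rw [hε]; field_simp
    have e2 : b / (a + b) * ε = (a + b + c)⁻¹ * b := by rw [hε]; field_simp
    rw [smul_smul, smul_smul, e1, e2, mul_smul, mul_smul, ← smul_add, h, smul_smul]
    congr 1; field_simp
  obtain ⟨p, q, hp, hq, hpq, hh⟩ :=
    hu.2.left_mem_of_mem_openSegment (hsc x hx) (hsc y hy) hmem hop
  refine ⟨ε⁻¹ * q, by positivity, ?_⟩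
  rw [smul_zero, zero_add] at hh
  rw [mul_smul, hh, smul_smul, inv_mul_cancel₀ hε0.ne', one_smul]

theorem IsEdge.not_three {P : Set (E 2)} (hP : Convex ℝ P) {u v w : E 2}
    (hu : IsEdge P 0 u) (hv : IsEdge P 0 v) (hw : IsEdge P 0 w)
    (huv : u ≠ v) (hvw : v ≠ w) (huw : u ≠ w) : False := by
  have mem : ∀ {z : E 2}, IsEdge P 0 z → z ∈ P := fun hz => hz.2.1 (right_mem_segment ℝ 0 _)
  have two : ∀ {x y z : E 2}, IsEdge P 0 x → IsEdge P 0 y → IsEdge P 0 z → x ≠ z →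
      ∀ a b c : ℝ, 0 < a → 0 ≤ b → 0 ≤ c → a • x + b • y = c • z → False := by
    intro x y z hx hy hz hxz a b c ha hb hc h
    obtain ⟨s, hs, hxs⟩ := hz.ray hP (mem hx) (mem hy) ha hb hc h
    exact hxz (hz.eq_of_smul hx hs hxs)
  have three : ∀ {x y z : E 2}, IsEdge P 0 x → IsEdge P 0 y → IsEdge P 0 z → x ≠ y →
      ∀ a b c : ℝ, 0 < a → 0 < b → 0 < c → a • x + b • y + c • z = 0 → False := by
    intro x y z hx hy hz hxy a b c ha hb hc h
    have hm : (b / (b + c)) • y + (c / (b + c)) • z ∈ P :=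
      hP (mem hy) (mem hz) (by positivity) (by positivity) (by field_simp)
    have hbc : b + c ≠ 0 := by positivity
    obtain ⟨s, hs, hxs⟩ := hy.ray hP (mem hx) hm ha (b := b + c) (c := 0) (by positivity)
      le_rfl (by
        rw [smul_add, smul_smul, smul_smul, mul_div_cancel₀ _ hbc, mul_div_cancel₀ _ hbc,
          zero_smul, ← add_assoc, h])
    exact hxy (hy.eq_of_smul hx hs hxs)
  have hdep : ¬ LinearIndependent ℝ ![u, v, w] := by
    intro h
    have := h.fintype_card_le_finrank
    simp at this
  obtain ⟨g, hg, i, hi⟩ := Fintype.not_linearIndependent_iff.1 hdep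
  rw [Fin.sum_univ_three] at hg
  simp only [Matrix.cons_val_zero, Matrix.cons_val_one, Matrix.cons_val_two, Matrix.head_cons,
    Matrix.tail_cons] at hg
  have main : ∀ α β γ : ℝ, α • u + β • v + γ • w = 0 → 0 ≤ α → (α ≠ 0 ∨ β ≠ 0 ∨ γ ≠ 0) →
      False := by
    intro α β γ h hα hne
    have e1 : α • u + β • v = (-γ) • w := by
      rw [neg_smul]; exact eq_neg_of_add_eq_zero_left h
    have e2 : α • u + γ • w = (-β) • v := by
      rw [neg_smul]; apply eq_neg_of_add_eq_zero_left; rw [← h]; abel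
    have e3 : (-β) • v + (-γ) • w = α • u := by
      rw [neg_smul, neg_smul, ← sub_eq_zero, ← neg_eq_zero, ← h]; abel
    have e4 : β • v + γ • w = (-α) • u := by
      rw [neg_smul]; apply eq_neg_of_add_eq_zero_left; rw [← h]; abel
    rcases hα.eq_or_lt with ha | ha
    · subst ha
      rcases lt_trichotomy β 0 with hb | hb | hb
      · rcases le_total γ 0 with hc | hc
        · exact two hv hw hu huv.symm _ _ _ (neg_pos.2 hb) (neg_nonneg.2 hc) le_rfl e3
        · exact two hv hu hw hvw (-β) 0 γ (neg_pos.2 hb) le_rfl hc (by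
            rw [← e2]; simp)
      · subst hb
        have hγ : γ ≠ 0 := by simpa using hne
        have : γ • w = 0 := by simpa using h
        rcases smul_eq_zero.1 this with h' | h'
        · exact hγ h'
        · exact hw.1 h'.symm
      · rcases le_total γ 0 with hc | hc
        · exact two hv hu hw hvw β 0 (-γ) hb le_rfl (neg_nonneg.2 hc) (by
            rw [← e1]; simp)
        · exact two hv hw hu huv.symm _ _ _ hb hc (by simp) e4
    · rcases le_or_gt 0 β with hb | hb
      · rcases le_or_gt γ 0 with hc | hc
        · exact two hu hv hw huw _ _ _ ha hb (neg_nonneg.2 hc) e1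
        · rcases hb.eq_or_lt with hb0 | hb0
          · subst hb0
            exact two hu hw hv huv _ _ _ ha hc.le (by simp) e2
          · exact three hu hv hw huv _ _ _ ha hb0 hc h
      · rcases le_or_gt γ 0 with hc | hc
        · exact two hv hw hu huv.symm _ _ _ (neg_pos.2 hb) (neg_nonneg.2 hc) hα e3
        · exact two hu hw hv huv _ _ _ ha hc.le (neg_nonneg.2 hb.le) e2
  have hne : g 0 ≠ 0 ∨ g 1 ≠ 0 ∨ g 2 ≠ 0 := by
    fin_cases i
    · exact Or.inl hi
    · exact Or.inr (Or.inl hi)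
    · exact Or.inr (Or.inr hi)
  rcases le_total 0 (g 0) with h0 | h0
  · exact main _ _ _ hg h0 hne
  · refine main (-g 0) (-g 1) (-g 2) ?_ (neg_nonneg.2 h0) (by simpa using hne)
    rw [neg_smul, neg_smul, neg_smul, ← neg_add, ← neg_add, hg, neg_zero]

theorem add_eq_add_of_mem_segment {n : ℕ} {v w v' w' : E n} (h1 : v' ∈ segment ℝ v w)
    (h2 : w' ∈ segment ℝ v w) (h3 : v ∈ segment ℝ v' w') (h4 : w ∈ segment ℝ v' w') :
    v + w = v' + w' := by
  rw [segment_eq_image'] at h1 h2 h3 h4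
  obtain ⟨s, ⟨hs0, hs1⟩, rfl⟩ := h1
  obtain ⟨t, ⟨ht0, ht1⟩, rfl⟩ := h2
  obtain ⟨a, ⟨ha0, ha1⟩, h3⟩ := h3
  obtain ⟨b, ⟨hb0, hb1⟩, h4⟩ := h4
  by_cases hd : w - v = 0
  · simp only [hd, smul_zero, add_zero]
    rw [sub_eq_zero.1 hd]
  have e3 : (s + a * (t - s)) • (w - v) = 0 := by
    have : (s + a * (t - s)) • (w - v)
        = (v + s • (w - v) + a • (v + t • (w - v) - (v + s • (w - v)))) - v := by module
    rw [this]; simp only at h3; rw [h3, sub_self]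
  have e4 : (s + b * (t - s) - 1) • (w - v) = 0 := by
    have : (s + b * (t - s) - 1) • (w - v)
        = (v + s • (w - v) + b • (v + t • (w - v) - (v + s • (w - v)))) - w := by module
    rw [this]; simp only at h4; rw [h4, sub_self]
  have f3 := (smul_eq_zero.1 e3).resolve_right hd
  have f4 := (smul_eq_zero.1 e4).resolve_right hd
  have hst : s + t = 1 := by
    rcases le_total s t with h | h
    · have hs : s = 0 := by nlinarith
      subst hs
      nlinarith
    · have ht : t = 0 := by nlinarith
      subst ht
      nlinarith
  have : t = 1 - s := by linarith
  subst this
  module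

theorem IsEValue.unique {P : Set (E 2)} (hP : Convex ℝ P) {x y : E 2}
    (hx : IsEValue P x) (hy : IsEValue P y) : x = y := by
  have c12 : ∀ v v' w' : E 2, IsEdge P 0 v → IsEdge P v' w' → 0 ∈ openSegment ℝ v' w' →
      False := by
    intro v v' w' hv hv' h0
    have m1 : v' ∈ P := hv'.2.1 (left_mem_segment ℝ v' w')
    have m2 : w' ∈ P := hv'.2.1 (right_mem_segment ℝ v' w')
    have h1 := hv.2.left_mem_of_mem_openSegment m1 m2 (left_mem_segment ℝ 0 v) h0
    have h2 := hv.2.right_mem_of_mem_openSegment m1 m2 (left_mem_segment ℝ 0 v) h0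
    obtain ⟨a, b, ha, hb, hab, rfl⟩ := h1
    obtain ⟨c, d, hc, hd, hcd, rfl⟩ := h2
    obtain ⟨p, q, hp, hq, hpq, hh⟩ := h0
    simp only [smul_zero, zero_add, smul_smul, ← add_smul] at hh
    have hz := (smul_eq_zero.1 hh).resolve_right hv.1.symm
    have hb0 : b = 0 := by nlinarith [mul_nonneg hp.le hb, mul_nonneg hq.le hd]
    have hd0 : d = 0 := by nlinarith [mul_nonneg hp.le hb, mul_nonneg hq.le hd]
    exact hv'.1 (by simp [hb0, hd0])
  rcases hx with ⟨hd, v, w, hvw, hv, hw, rfl⟩ | ⟨hd, v, w, hvw, h0, rfl⟩ |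
      ⟨hd, v, w, hvw, h0, rfl⟩ <;>
    rcases hy with ⟨hd', v', w', hvw', hv', hw', rfl⟩ | ⟨hd', v', w', hvw', h0', rfl⟩ |
      ⟨hd', v', w', hvw', h0', rfl⟩ <;>
    try omega
  · have k1 : v' = v ∨ v' = w := by
      by_contra! h
      exact IsEdge.not_three hP hv' hv hw h.1 hvw h.2
    have k2 : w' = v ∨ w' = w := by
      by_contra! h
      exact IsEdge.not_three hP hw' hv hw h.1 hvw h.2
    rcases k1 with rfl | rfl <;> rcases k2 with rfl | rfl
    · exact absurd rfl hvw'
    · rfl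
    · exact add_comm _ _
    · exact absurd rfl hvw'
  · exact (c12 v v' w' hv hvw' h0').elim
  · exact (c12 v' v w hv' hvw h0).elim
  · have m1 : v ∈ P := hvw.2.1 (left_mem_segment ℝ v w)
    have m2 : w ∈ P := hvw.2.1 (right_mem_segment ℝ v w)
    have m3 : v' ∈ P := hvw'.2.1 (left_mem_segment ℝ v' w')
    have m4 : w' ∈ P := hvw'.2.1 (right_mem_segment ℝ v' w')
    have z : (0 : E 2) ∈ segment ℝ v w := openSegment_subset_segment ℝ v w h0
    have z' : (0 : E 2) ∈ segment ℝ v' w' := openSegment_subset_segment ℝ v' w' h0'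
    exact add_eq_add_of_mem_segment
      (hvw.2.left_mem_of_mem_openSegment m3 m4 z h0')
      (hvw.2.right_mem_of_mem_openSegment m3 m4 z h0')
      (hvw'.2.left_mem_of_mem_openSegment m1 m2 z' h0)
      (hvw'.2.right_mem_of_mem_openSegment m1 m2 z' h0)
  · congr 1
    exact add_eq_add_of_mem_segment
      (hvw ▸ hvw' ▸ left_mem_segment ℝ v' w') (hvw ▸ hvw' ▸ right_mem_segment ℝ v' w')
      (hvw' ▸ hvw ▸ left_mem_segment ℝ v w) (hvw' ▸ hvw ▸ right_mem_segment ℝ v w)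

theorem IsEValue.eVector_eq {P : Set (E 2)} (hP : Convex ℝ P) {x : E 2}
    (hx : IsEValue P x) : eVector P = x := by
  have h : ∃ x, IsEValue P x := ⟨x, hx⟩
  rw [eVector, dif_pos h]
  exact IsEValue.unique hP h.choose_spec hx

end PlanarValuation

end

/-! Every polytope containing the origin can be cut by lines through the origin into triangles with
a vertex at the origin and segments with an end there. A valuation is additive under such cuts
(`IsCutAdditive`), so it is determined by its values on these pieces (`IsCutAdditive.eq_zero`).
Conversely, cut additivity implies the valuation property (`IsCutAdditive.isValuation`): cutting
`P`, `Q`, `P ∪ Q`, `P ∩ Q` simultaneously along enough lines reduces to triangles on two common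
rays, where convexity of the union forces one triangle to contain the other.

For `φ` in `SL(2)` the rotation `ρ` by a right angle satisfies `φ⁻ᵗ ρ = ρ φ`, so contravariance of
`Z` is covariance of `ρ⁻¹ Z`. Hence `Z = ρ(c v)` on the segment from `o` to `v`, and `Z = ρ(α(D) v +
β(D) w)` on the triangle `o, v, w` with `D = det(v, w) > 0`. Splitting a triangle of determinant `p
+ q` into triangles of determinants `p` and `q` gives a functional equation for `α`, `β`, `c`. Its
solutions are `α(D) = k D + ζ(D)/D + c/2` and `β(D) = k D - ζ(D)/D + c/2` with `ζ` additive
(`exists_cauchy_of_triangle`).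

The three terms of the theorem realise exactly these coefficients (`canonical_tri`,
`canonical_tri_zero`): on a triangle the moment vector is a multiple of `D (v + w)`, `e` is `v + w`,
and the facet vector is a multiple of `ρ(v - w)`. It remains that each term is cut additive. For the
moment vector this is additivity of the integral. For the facet vector it holds direction by
direction, because a cut divides each facet cone into two cones whose areas add (`facetTerm_half`).
For `e` it follows after rewriting `e(P)` as the sum of the last points of `P` on the boundary rays
of its cone (`eVector_eq_tipSum`, `tipSum_isCutAdditive`). -/

noncomputable section

namespace PlanarValuation

/-! ### The planar cross product -/

/-- The determinant of the pair `(a, x)`. -/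
def cross (a x : E 2) : ℝ := a 0 * x 1 - a 1 * x 0

/-- The counter-clockwise rotation by a right angle. -/
def quarter : E 2 →ₗ[ℝ] E 2 := act !![0, -1; 1, 0]

theorem ext_coord {x y : E 2} (h0 : x 0 = y 0) (h1 : x 1 = y 1) : x = y := by
  ext i; fin_cases i
  · exact h0
  · exact h1

theorem act_apply_zero (A : Matrix (Fin 2) (Fin 2) ℝ) (x : E 2) :
    act A x 0 = A 0 0 * x 0 + A 0 1 * x 1 := by
  simp [act, Matrix.toLpLin_apply]

theorem act_apply_one (A : Matrix (Fin 2) (Fin 2) ℝ) (x : E 2) :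
    act A x 1 = A 1 0 * x 0 + A 1 1 * x 1 := by
  simp [act, Matrix.toLpLin_apply]

@[simp] theorem quarter_apply_zero (x : E 2) : quarter x 0 = -x 1 := by
  simp [quarter, act_apply_zero]

@[simp] theorem quarter_apply_one (x : E 2) : quarter x 1 = x 0 := by
  simp [quarter, act_apply_one]

theorem rot_eq_quarter : rot (Real.pi / 2) = quarter := by
  simp [rot, quarter]

theorem cross_add_right (a x y : E 2) : cross a (x + y) = cross a x + cross a y := by
  simp [cross]; ring

theorem cross_sub_right (a x y : E 2) : cross a (x - y) = cross a x - cross a y := by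
  simp [cross]; ring

theorem cross_smul_right (a x : E 2) (t : ℝ) : cross a (t • x) = t * cross a x := by
  simp [cross]; ring

theorem cross_add_left (a b x : E 2) : cross (a + b) x = cross a x + cross b x := by
  simp [cross]; ring

theorem cross_smul_left (a x : E 2) (t : ℝ) : cross (t • a) x = t * cross a x := by
  simp [cross]; ring

@[simp] theorem cross_neg_left (a x : E 2) : cross (-a) x = -cross a x := by
  simp [cross]; ring

@[simp] theorem cross_self (a : E 2) : cross a a = 0 := by
  simp [cross]; ring

@[simp] theorem cross_zero_right (a : E 2) : cross a 0 = 0 := by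
  simp [cross]

@[simp] theorem cross_zero_left (a : E 2) : cross 0 a = 0 := by
  simp [cross]

theorem cross_swap (a b : E 2) : cross a b = -cross b a := by
  simp [cross]; ring

theorem cross_quarter_self_pos {a : E 2} (ha : a ≠ 0) : 0 < cross a (quarter a) := by
  have : cross a (quarter a) = a 0 ^ 2 + a 1 ^ 2 := by simp [cross]; ring
  rw [this]
  by_contra! h
  exact ha (ext_coord (by simp; nlinarith [sq_nonneg (a 0), sq_nonneg (a 1)])
    (by simp; nlinarith [sq_nonneg (a 0), sq_nonneg (a 1)]))

theorem inner_quarter (x y : E 2) : inner ℝ (quarter x) y = cross x y := by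
  simp [PiLp.inner_apply, Fin.sum_univ_two, cross]; ring

theorem continuous_cross (a : E 2) : Continuous (cross a) := by
  unfold cross; fun_prop

theorem exists_smul_of_cross_eq_zero {a x : E 2} (ha : a ≠ 0) (h : cross a x = 0) :
    ∃ t : ℝ, x = t • a := by
  have h2 := cross_quarter_self_pos ha
  have h1 : cross a (quarter a) = a 0 ^ 2 + a 1 ^ 2 := by simp [cross]; ring
  rw [h1] at h2
  refine ⟨(a 0 * x 0 + a 1 * x 1) / (a 0 ^ 2 + a 1 ^ 2), ext_coord ?_ ?_⟩ <;>
    simp only [PiLp.smul_apply, smul_eq_mul] <;> unfold cross at h <;> field_simp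
  · linear_combination a 1 * -h
  · linear_combination a 0 * h

/-- Cramer's rule. -/
theorem eq_smul_add_smul {v w : E 2} (h : cross v w ≠ 0) (x : E 2) :
    x = (cross x w / cross v w) • v + (cross v x / cross v w) • w := by
  refine ext_coord ?_ ?_ <;> simp only [PiLp.smul_apply, PiLp.add_apply, smul_eq_mul] <;>
    field_simp <;> unfold cross <;> ring

/-! ### Polytopes and their sections by lines through the origin -/

theorem IsPolytope.convex {n : ℕ} {P : Set (E n)} (h : IsPolytope P) : Convex ℝ P := by
  obtain ⟨S, rfl⟩ := h
  exact convex_convexHull ℝ _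

theorem IsPolytope.isCompact {n : ℕ} {P : Set (E n)} (h : IsPolytope P) : IsCompact P := by
  obtain ⟨S, rfl⟩ := h
  exact S.finite_toSet.isCompact_convexHull ℝ

theorem IsPolytope.finite_extremePoints {n : ℕ} {P : Set (E n)} (h : IsPolytope P) :
    (P.extremePoints ℝ).Finite := by
  obtain ⟨S, rfl⟩ := h
  exact S.finite_toSet.subset extremePoints_convexHull_subset

/-- Krein–Milman; the closure is superfluous because the hull of finitely many points is already
compact. -/
theorem isPolytope_of_finite_extremePoints {n : ℕ} {P : Set (E n)} (hc : IsCompact P)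
    (hconv : Convex ℝ P) (hf : (P.extremePoints ℝ).Finite) : IsPolytope P := by
  refine ⟨hf.toFinset, ?_⟩
  rw [Set.Finite.coe_toFinset, ← (hf.isCompact_convexHull ℝ).isClosed.closure_eq,
    closure_convexHull_extremePoints hc hconv]

theorem IsPolytope.convexHull_extremePoints {n : ℕ} {P : Set (E n)} (h : IsPolytope P) :
    convexHull ℝ (P.extremePoints ℝ) = P := by
  rw [← (h.finite_extremePoints.isCompact_convexHull ℝ).isClosed.closure_eq,
    closure_convexHull_extremePoints h.isCompact h.convex]

theorem convex_inter_cross {P : Set (E 2)} (hP : Convex ℝ P) (a : E 2) :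
    Convex ℝ (P ∩ {x | 0 ≤ cross a x}) := by
  refine hP.inter fun x hx y hy s t hs ht _ => ?_
  simp only [Set.mem_ofPred_eq, cross_add_right, cross_smul_right] at *
  positivity

theorem isClosed_cross_nonneg (a : E 2) : IsClosed {x | 0 ≤ cross a x} :=
  isClosed_le continuous_const (continuous_cross a)

/-- An extreme point of the part of `P` in a half plane is an extreme point of `P` or lies on the
boundary line of the half plane. -/
theorem extremePoints_inter_cross {P : Set (E 2)} (hP : Convex ℝ P) {a x : E 2}
    (hx : x ∈ (P ∩ {x | 0 ≤ cross a x}).extremePoints ℝ) (h : cross a x ≠ 0) :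
    x ∈ P.extremePoints ℝ := by
  have hpos : 0 < cross a x := lt_of_le_of_ne hx.1.2 h.symm
  refine ⟨hx.1.1, ?_⟩
  rintro p hp q hq ⟨s, t, hs, ht, hst, hxe⟩
  -- Since `x` lies strictly inside the half plane, shrinking the segment from `p` to `q` towards
  -- `x` by a small factor `ε` brings both ends into the half plane, where extremality of `x`
  -- applies.
  obtain ⟨ε, hε0, hε1, hεp, hεq⟩ : ∃ ε : ℝ, 0 < ε ∧ ε ≤ 1 ∧
      0 ≤ (1 - ε) * cross a x + ε * cross a p ∧ 0 ≤ (1 - ε) * cross a x + ε * cross a q := by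
    have hM : 0 < cross a x + |cross a p| + |cross a q| := by positivity
    refine ⟨cross a x / (cross a x + |cross a p| + |cross a q|), by positivity, ?_, ?_, ?_⟩
    · rw [div_le_one hM]; linarith [abs_nonneg (cross a p), abs_nonneg (cross a q)]
    · have e : (1 - cross a x / (cross a x + |cross a p| + |cross a q|)) * cross a x
          + cross a x / (cross a x + |cross a p| + |cross a q|) * cross a p
          = cross a x / (cross a x + |cross a p| + |cross a q|)
            * (|cross a p| + cross a p + |cross a q|) := by field_simp; ring
      rw [e]
      have := neg_abs_le (cross a p)
      have h2 := abs_nonneg (cross a q)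
      exact mul_nonneg (by positivity) (by linarith)
    · have e : (1 - cross a x / (cross a x + |cross a p| + |cross a q|)) * cross a x
          + cross a x / (cross a x + |cross a p| + |cross a q|) * cross a q
          = cross a x / (cross a x + |cross a p| + |cross a q|)
            * (|cross a p| + (|cross a q| + cross a q)) := by field_simp; ring
      rw [e]
      have := neg_abs_le (cross a q)
      have h2 := abs_nonneg (cross a p)
      exact mul_nonneg (by positivity) (by linarith)
  have hmem : ∀ y ∈ P, 0 ≤ (1 - ε) * cross a x + ε * cross a y →
      (1 - ε) • x + ε • y ∈ P ∩ {x | 0 ≤ cross a x} := fun y hy hy' =>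
    ⟨hP hx.1.1 hy (by linarith) hε0.le (by ring), by
      simpa [cross_add_right, cross_smul_right] using hy'⟩
  have := hx.2 (hmem p hp hεp) (hmem q hq hεq) ⟨s, t, hs, ht, hst, by
    have e : s • ((1 - ε) • x + ε • p) + t • ((1 - ε) • x + ε • q)
      = ((s + t) * (1 - ε)) • x + ε • (s • p + t • q) := by module
    rw [e, hxe, hst]; module⟩
  have h0 : ε • (p - x) = 0 := by
    have e : ε • (p - x) = ((1 - ε) • x + ε • p) - x := by module
    rw [e, this, sub_self]
  exact sub_eq_zero.1 ((smul_eq_zero.1 h0).resolve_left hε0.ne')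

/-- A linear functional injective on the line attains its minimum and maximum over `K` at single
points; every other point of `K` lies strictly between these two, so it is not extreme. -/
theorem finite_extremePoints_of_subset_line {K : Set (E 2)} (hK : IsCompact K)
    {a : E 2} (ha : a ≠ 0) (hKa : ∀ x ∈ K, cross a x = 0) : (K.extremePoints ℝ).Finite := by
  rcases K.eq_empty_or_nonempty with rfl | hne
  · simp
  have hcont : Continuous fun x : E 2 => cross (quarter a) x := continuous_cross _
  obtain ⟨p, hp, hpmin⟩ := hK.exists_isMinOn hne hcont.continuousOn
  obtain ⟨q, hq, hqmax⟩ := hK.exists_isMaxOn hne hcont.continuousOn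
  refine (Set.toFinite {p, q}).subset fun x hx => ?_
  obtain ⟨s, rfl⟩ := exists_smul_of_cross_eq_zero ha (hKa p hp)
  obtain ⟨t, rfl⟩ := exists_smul_of_cross_eq_zero ha (hKa q hq)
  obtain ⟨r, rfl⟩ := exists_smul_of_cross_eq_zero ha (hKa x hx.1)
  have hneg : cross (quarter a) a < 0 := by
    rw [cross_swap]; linarith [cross_quarter_self_pos ha]
  have h1 := hpmin hx.1
  have h2 := hqmax hx.1
  simp only [Set.mem_ofPred_eq, cross_smul_right] at h1 h2
  have h1' : r ≤ s := by nlinarith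
  have h2' : t ≤ r := by nlinarith
  rcases h1'.eq_or_lt with rfl | h1'
  · simp
  rcases h2'.eq_or_lt with rfl | h2'
  · simp
  have := hx.2 hq hp ⟨(s - r) / (s - t), (r - t) / (s - t), div_pos (by linarith) (by linarith),
    div_pos (by linarith) (by linarith), by
      have : s - t ≠ 0 := by linarith
      field_simp; ring, by
      have : s - t ≠ 0 := by linarith
      rw [smul_smul, smul_smul, ← add_smul]; congr 1; field_simp; ring⟩
  right; exact this.symm

/-- Extreme points of the section off the boundary line are extreme in `P`; those on the line are
extreme in the part of `P` on that line. Both sets are finite. -/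
theorem IsPolytope.inter_cross {P : Set (E 2)} (hP : IsPolytope P) {a : E 2} (ha : a ≠ 0) :
    IsPolytope (P ∩ {x | 0 ≤ cross a x}) := by
  refine isPolytope_of_finite_extremePoints
    (hP.isCompact.inter_right (isClosed_cross_nonneg a)) (convex_inter_cross hP.convex a) ?_
  have hline : IsCompact (P ∩ {x | cross a x = 0}) :=
    hP.isCompact.inter_right (isClosed_eq (continuous_cross a) continuous_const)
  have hsub : P ∩ {x | cross a x = 0} ⊆ P ∩ {x | 0 ≤ cross a x} :=
    fun y hy => ⟨hy.1, hy.2.ge⟩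
  refine (hP.finite_extremePoints.union
    (finite_extremePoints_of_subset_line hline ha fun x hx => hx.2)).subset fun x hx => ?_
  by_cases h : cross a x = 0
  · exact Or.inr (inter_extremePoints_subset_extremePoints_of_subset hsub ⟨⟨hx.1.1, h⟩, hx⟩)
  · exact Or.inl (extremePoints_inter_cross hP.convex hx h)

/-! ### Half-plane sections and triangles with a vertex at the origin -/

/-- The part of `P` in the half plane to the left of the vector `a` (all of `P` if `a = 0`). -/
def PolyO.half (a : E 2) (P : PolyO 2) : PolyO 2 :=
  ⟨P.1 ∩ {x | 0 ≤ cross a x}, by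
    refine ⟨?_, P.2.2, by simp⟩
    rcases eq_or_ne a 0 with rfl | ha
    · simpa using P.2.1
    · exact P.2.1.inter_cross ha⟩

theorem PolyO.ext {n : ℕ} {P Q : PolyO n} (h : P.1 = Q.1) : P = Q := Subtype.ext h

theorem PolyO.mem_half {a x : E 2} {P : PolyO 2} : x ∈ (P.half a).1 ↔ x ∈ P.1 ∧ 0 ≤ cross a x :=
  Iff.rfl

theorem PolyO.convex {n : ℕ} (P : PolyO n) : Convex ℝ P.1 := P.2.1.convex

theorem PolyO.isCompact {n : ℕ} (P : PolyO n) : IsCompact P.1 := P.2.1.isCompact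

theorem PolyO.smul_mem {n : ℕ} (P : PolyO n) {x : E n} (hx : x ∈ P.1) {t : ℝ} (h0 : 0 ≤ t)
    (h1 : t ≤ 1) : t • x ∈ P.1 :=
  P.convex.smul_mem_of_zero_mem P.2.2 hx ⟨h0, h1⟩

/-- The convex hull of the origin and two points. -/
def tri (v w : E 2) : PolyO 2 :=
  ⟨convexHull ℝ {0, v, w}, ⟨by classical exact ⟨{0, v, w}, by simp⟩,
    subset_convexHull ℝ _ (by simp)⟩⟩

theorem mem_tri {v w x : E 2} : x ∈ (tri v w).1 ↔
    ∃ s t : ℝ, 0 ≤ s ∧ 0 ≤ t ∧ s + t ≤ 1 ∧ x = s • v + t • w := by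
  change x ∈ convexHull ℝ {0, v, w} ↔ _
  rw [convexHull_insert (by simp), convexHull_pair, mem_convexJoin]
  constructor
  · rintro ⟨_, rfl, _, ⟨a, b, ha, hb, hab, rfl⟩, ⟨c, d, hc, hd, hcd, rfl⟩⟩
    refine ⟨d * a, d * b, by positivity, by positivity, ?_, by module⟩
    rw [← mul_add, hab]; linarith
  · rintro ⟨s, t, hs, ht, hst, rfl⟩
    refine ⟨0, rfl, ?_⟩
    rcases (add_nonneg hs ht).eq_or_lt with h | h
    · refine ⟨v, left_mem_segment ℝ v w, ?_⟩
      have h1 : s = 0 := by linarith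
      have h2 : t = 0 := by linarith
      simp [h1, h2, left_mem_segment]
    · refine ⟨(s / (s + t)) • v + (t / (s + t)) • w, ⟨_, _, by positivity, by positivity,
        by field_simp, rfl⟩, ⟨1 - (s + t), s + t, by linarith, h.le, by ring, ?_⟩⟩
      rw [smul_zero, zero_add, smul_add, smul_smul, smul_smul, mul_div_cancel₀ _ h.ne',
        mul_div_cancel₀ _ h.ne']

theorem left_mem_tri (v w : E 2) : v ∈ (tri v w).1 := subset_convexHull ℝ _ (by simp)

theorem right_mem_tri (v w : E 2) : w ∈ (tri v w).1 := subset_convexHull ℝ _ (by simp)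

theorem tri_comm (v w : E 2) : tri v w = tri w v := by
  apply PolyO.ext
  change convexHull ℝ {0, v, w} = convexHull ℝ {0, w, v}
  rw [Set.pair_comm]

/-- These are the barycentric inequalities, with the coordinates given by Cramer's rule and the
denominator `cross v w` cleared. -/
theorem mem_tri_iff {v w x : E 2} (h : 0 < cross v w) : x ∈ (tri v w).1 ↔
    0 ≤ cross x w ∧ 0 ≤ cross v x ∧ cross x w + cross v x ≤ cross v w := by
  rw [mem_tri]
  constructor
  · rintro ⟨s, t, hs, ht, hst, rfl⟩
    simp only [cross_add_left, cross_add_right, cross_smul_left, cross_smul_right, cross_self]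
    refine ⟨by positivity, by positivity, by nlinarith⟩
  · rintro ⟨h1, h2, h3⟩
    refine ⟨_, _, by positivity, by positivity, ?_, eq_smul_add_smul h.ne' x⟩
    rw [← add_div, div_le_one h]; exact h3

theorem map_tri (φ : Matrix.SpecialLinearGroup (Fin 2) ℝ) (v w : E 2) :
    (tri v w).map φ = tri (act (φ : Matrix (Fin 2) (Fin 2) ℝ) v)
      (act (φ : Matrix (Fin 2) (Fin 2) ℝ) w) := by
  apply PolyO.ext
  change act (φ : Matrix (Fin 2) (Fin 2) ℝ) '' (convexHull ℝ {0, v, w}) = convexHull ℝ _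
  rw [LinearMap.image_convexHull, Set.image_insert_eq, Set.image_pair, map_zero]

section Cut

/-! ### Cutting families of polytopes into triangles -/

/-- Parallel nonzero vectors in a common quadrant point in the same direction. -/
theorem smul_pos_of_quadrant {a : E 2} {t : ℝ} (hx : 0 ≤ a 0 * (t * a 0)) (hy : 0 ≤ a 1 * (t * a 1))
    (ha : a ≠ 0) : 0 ≤ t := by
  by_contra! h
  refine ha (ext_coord ?_ ?_)
  · by_contra h0
    have h1 : a 0 ≠ 0 := by simpa using h0
    have : 0 < a 0 ^ 2 := by positivity
    nlinarith
  · by_contra h0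
    have h1 : a 1 ≠ 0 := by simpa using h0
    have : 0 < a 1 ^ 2 := by positivity
    nlinarith

/-- As the origin belongs to `P`, the nearer of two distinct points on a ray lies strictly between
the origin and the farther one and cannot be extreme. -/
theorem PolyO.eq_of_smul_mem_extremePoints {n : ℕ} (P : PolyO n) {v : E n} {s t : ℝ} (hs : 0 < s)
    (ht : 0 < t) (h1 : s • v ∈ P.1.extremePoints ℝ) (h2 : t • v ∈ P.1.extremePoints ℝ) :
    s • v = t • v := by
  have key : ∀ s t : ℝ, 0 < s → s < t → s • v ∈ P.1.extremePoints ℝ →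
      t • v ∈ P.1.extremePoints ℝ → s • v = t • v := by
    intro s t hs hst h1 h2
    have ht : 0 < t := hs.trans hst
    refine ((mem_extremePoints.1 h1).2 0 P.2.2 _ h2.1 ⟨1 - s / t, s / t, ?_, by positivity,
      by ring, ?_⟩).2.symm
    · rw [sub_pos, div_lt_one ht]; exact hst
    · rw [smul_zero, zero_add, smul_smul, div_mul_cancel₀ _ ht.ne']
  rcases lt_trichotomy s t with h | h | h
  · exact key s t hs h h1 h2
  · rw [h]
  · exact (key t s ht h h2 h1).symm

/-- If all extreme points of `P` lie on two rays, then `P` is a triangle spanned by points on these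
rays. -/
theorem PolyO.eq_tri_of_extremePoints (P : PolyO 2) {v w : E 2}
    (h : ∀ z ∈ P.1.extremePoints ℝ, z ≠ 0 → ∃ s : ℝ, 0 < s ∧ (z = s • v ∨ z = s • w)) :
    ∃ s t : ℝ, 0 ≤ s ∧ 0 ≤ t ∧ P = tri (s • v) (t • w) := by
  have aux : ∀ v : E 2, ∃ s : ℝ, 0 ≤ s ∧ s • v ∈ P.1 ∧
      ∀ r : ℝ, 0 < r → r • v ∈ P.1.extremePoints ℝ → r • v = s • v := by
    intro v
    by_cases hv : ∃ s : ℝ, 0 < s ∧ s • v ∈ P.1.extremePoints ℝ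
    · obtain ⟨s, hs, hsv⟩ := hv
      exact ⟨s, hs.le, hsv.1, fun r hr hrv => P.eq_of_smul_mem_extremePoints hr hs hrv hsv⟩
    · push Not at hv
      -- A ray without nonzero extreme points gets length `0`, so degenerate triangles are allowed.
      exact ⟨0, le_rfl, by simpa using P.2.2, fun r hr hrv => absurd hrv (hv r hr)⟩
  obtain ⟨s, hs, hsP, hs'⟩ := aux v
  obtain ⟨t, ht, htP, ht'⟩ := aux w
  refine ⟨s, t, hs, ht, PolyO.ext (Set.Subset.antisymm ?_ ?_)⟩
  · rw [← P.2.1.convexHull_extremePoints]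
    refine convexHull_mono fun z hz => ?_
    rcases eq_or_ne z 0 with rfl | hz0
    · simp
    obtain ⟨r, hr, rfl | rfl⟩ := h z hz hz0
    · simp [hs' r hr hz]
    · simp [ht' r hr hz]
  · refine convexHull_min ?_ P.convex
    rintro z (rfl | rfl | rfl)
    exacts [P.2.2, hsP, htP]

variable {ι : Type*}

/-- If the family `P` lies in one quadrant and every extreme point of a member spans a line that
supports the whole family, then all members are triangles spanned by the same two rays. -/
theorem exists_forall_eq_tri (P : ι → PolyO 2)
    (h0 : ∀ i j, ∀ x ∈ (P i).1, ∀ y ∈ (P j).1, 0 ≤ x 0 * y 0)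
    (h1 : ∀ i j, ∀ x ∈ (P i).1, ∀ y ∈ (P j).1, 0 ≤ x 1 * y 1)
    (h : ∀ i, ∀ z ∈ (P i).1.extremePoints ℝ, z ≠ 0 →
      (∀ j, ∀ y ∈ (P j).1, 0 ≤ cross z y) ∨ (∀ j, ∀ y ∈ (P j).1, cross z y ≤ 0)) :
    ∃ v w : E 2, 0 < cross v w ∧ ∀ i, ∃ s t : ℝ, 0 ≤ s ∧ 0 ≤ t ∧ P i = tri (s • v) (t • w) := by
  -- The quadrant hypotheses exclude opposite directions: parallel nonzero points lie on one ray.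
  have ray : ∀ i j, ∀ x ∈ (P i).1, ∀ y ∈ (P j).1, x ≠ 0 → y ≠ 0 → cross x y = 0 →
      ∃ s : ℝ, 0 < s ∧ y = s • x := by
    intro i j x hx y hy hx0 hy0 hxy
    obtain ⟨s, rfl⟩ := exists_smul_of_cross_eq_zero hx0 hxy
    have hs : 0 ≤ s := smul_pos_of_quadrant (h0 i j _ hx _ hy) (h1 i j _ hx _ hy) hx0
    refine ⟨s, lt_of_le_of_ne hs ?_, rfl⟩
    rintro rfl
    simp at hy0
  -- If two extreme points `x`, `y` have positive determinant, their rays bound the cone of the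
  -- whole family. Any other nonzero extreme point also spans a supporting line, so it must be on
  -- one of these two rays.
  by_cases hne : ∃ i j, ∃ x ∈ (P i).1.extremePoints ℝ, ∃ y ∈ (P j).1.extremePoints ℝ,
      0 < cross x y
  · obtain ⟨i, j, x, hx, y, hy, hxy⟩ := hne
    have hx0 : x ≠ 0 := by rintro rfl; simp at hxy
    have hy0 : y ≠ 0 := by rintro rfl; simp at hxy
    have hxr : ∀ j, ∀ y ∈ (P j).1, 0 ≤ cross x y :=
      (h i x hx hx0).resolve_right fun hc => absurd (hc j y hy.1) (by linarith)
    have hyl : ∀ j, ∀ x ∈ (P j).1, cross y x ≤ 0 :=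
      (h j y hy hy0).resolve_left fun hc => by
        have := hc i x hx.1
        rw [cross_swap] at this; linarith
    refine ⟨x, y, hxy, fun k => (P k).eq_tri_of_extremePoints fun z hz hz0 => ?_⟩
    rcases h k z hz hz0 with hzr | hzl
    · have e : cross x z = 0 := le_antisymm (by
        rw [cross_swap]; linarith [hzr i x hx.1]) (hxr k z hz.1)
      obtain ⟨s, hs, e⟩ := ray i k x hx.1 z hz.1 hx0 hz0 e
      exact ⟨s, hs, Or.inl e⟩
    · have e : cross y z = 0 := le_antisymm (hyl k z hz.1) (by
        rw [cross_swap]; linarith [hzl j y hy.1])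
      obtain ⟨s, hs, e⟩ := ray j k y hy.1 z hz.1 hy0 hz0 e
      exact ⟨s, hs, Or.inr e⟩
  -- Otherwise all extreme points are parallel: a single ray suffices, and the second one is
  -- arbitrary.
  · push Not at hne
    have hz : ∀ i j, ∀ x ∈ (P i).1.extremePoints ℝ, ∀ y ∈ (P j).1.extremePoints ℝ,
        cross x y = 0 := fun i j x hx y hy => le_antisymm (hne i j x hx y hy) (by
      rw [cross_swap]; linarith [hne j i y hy x hx])
    by_cases hex : ∃ i, ∃ x ∈ (P i).1.extremePoints ℝ, x ≠ 0
    · obtain ⟨i, x, hx, hx0⟩ := hex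
      refine ⟨x, quarter x, cross_quarter_self_pos hx0,
        fun k => (P k).eq_tri_of_extremePoints fun z hz' hz0 => ?_⟩
      obtain ⟨s, hs, e⟩ := ray i k x hx.1 z hz'.1 hx0 hz0 (hz i k x hx z hz')
      exact ⟨s, hs, Or.inl e⟩
    · push Not at hex
      refine ⟨!₂[1, 0], !₂[0, 1], by simp [cross], fun k =>
        (P k).eq_tri_of_extremePoints fun z hz' hz0 => absurd (hex k z hz') hz0⟩

/-- A function of a family of polytopes that is additive under cuts by lines through the origin
vanishes if it vanishes on families of triangles spanned by two common rays. -/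
theorem eq_zero_of_cut [Finite ι] {V : Type*} [AddCommGroup V] (F : (ι → PolyO 2) → V)
    (hF : ∀ (a : E 2) (P : ι → PolyO 2), a ≠ 0 → F P + F (fun i => ((P i).half a).half (-a))
      = F (fun i => (P i).half a) + F (fun i => (P i).half (-a)))
    (C : (ι → PolyO 2) → Prop) (hC : ∀ a P, a ≠ 0 → C P → C (fun i => (P i).half a))
    (h : ∀ (P : ι → PolyO 2) (v w : E 2), C P → 0 < cross v w →
      (∀ i, ∃ s t : ℝ, 0 ≤ s ∧ 0 ≤ t ∧ P i = tri (s • v) (t • w)) → F P = 0)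
    (P : ι → PolyO 2) (hP : C P) : F P = 0 := by
  classical
  have hfin : (⋃ i, (P i).1.extremePoints ℝ).Finite :=
    Set.finite_iUnion fun i => (P i).2.1.finite_extremePoints
  -- Cuts along the two axes confine each family of pieces to one quadrant; cuts along the remaining
  -- directions make every extreme point span a supporting line.
  set L : List (E 2) :=
    !₂[1, 0] :: !₂[0, 1] :: (hfin.toFinset.toList.filter (fun x => x ≠ 0)) with hL
  have hL0 : ∀ a ∈ L, a ≠ 0 := by
    intro a ha
    simp only [hL, List.mem_cons, List.mem_filter, decide_eq_true_eq] at ha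
    rcases ha with rfl | rfl | ha
    · intro h0; simpa using congrArg (fun x : E 2 => x 0) h0
    · intro h0; simpa using congrArg (fun x : E 2 => x 1) h0
    · exact ha.2
  -- `M` lists the directions still to be cut. The invariant is that nonzero extreme points lie on
  -- lines from `L`, and that each line of `L` outside `M` has the whole family on one side.
  have main : ∀ M : List (E 2), (∀ a ∈ M, a ∈ L) → ∀ Q : ι → PolyO 2, C Q →
      (∀ i, ∀ x ∈ (Q i).1.extremePoints ℝ, x ≠ 0 → ∃ a ∈ L, cross a x = 0) →
      (∀ a ∈ L, a ∉ M → (∀ i, ∀ x ∈ (Q i).1, 0 ≤ cross a x) ∨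
        (∀ i, ∀ x ∈ (Q i).1, 0 ≤ cross (-a) x)) → F Q = 0 := by
    intro M
    induction M with
    | nil =>
      intro _ Q hQ hext hsgn
      have e1 := hsgn !₂[1, 0] (by simp [hL]) (by simp)
      have e2 := hsgn !₂[0, 1] (by simp [hL]) (by simp)
      have key : ∃ v w : E 2, 0 < cross v w ∧
          ∀ i, ∃ s t : ℝ, 0 ≤ s ∧ 0 ≤ t ∧ Q i = tri (s • v) (t • w) := by
        refine exists_forall_eq_tri Q ?_ ?_ ?_
        · intro i j x hx y hy
          rcases e2 with e | e
          · have := e i x hx; have := e j y hy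
            simp [cross] at *; nlinarith
          · have := e i x hx; have := e j y hy
            simp [cross] at *; nlinarith
        · intro i j x hx y hy
          rcases e1 with e | e
          · have := e i x hx; have := e j y hy
            simp [cross] at *; nlinarith
          · have := e i x hx; have := e j y hy
            simp [cross] at *; nlinarith
        · intro i z hz hz0
          obtain ⟨a, haL, haz⟩ := hext i z hz hz0
          obtain ⟨t, rfl⟩ := exists_smul_of_cross_eq_zero (hL0 a haL) haz
          simp only [cross_smul_left]
          have e := hsgn a haL (by simp)
          simp only [cross_neg_left, neg_nonneg] at e
          rcases le_total 0 t with ht | ht <;> rcases e with e | e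
          · exact Or.inl fun j y hy => mul_nonneg ht (e j y hy)
          · exact Or.inr fun j y hy => mul_nonpos_of_nonneg_of_nonpos ht (e j y hy)
          · exact Or.inr fun j y hy => mul_nonpos_of_nonpos_of_nonneg ht (e j y hy)
          · exact Or.inl fun j y hy => mul_nonneg_of_nonpos_of_nonpos ht (e j y hy)
      obtain ⟨v, w, hvw, hQ'⟩ := key
      exact h Q v w hQ hvw hQ'
    | cons b M ih =>
      intro hM Q hQ hext hsgn
      have hbL := hM b (by simp)
      have hb0 := hL0 b hbL
      -- A cut creates new extreme points only on the cutting line, which itself belongs to `L`.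
      have step : ∀ c : E 2, (c = b ∨ c = -b) → ∀ R : ι → PolyO 2,
          (∀ i, ∀ x ∈ (R i).1.extremePoints ℝ, x ≠ 0 → ∃ a ∈ L, cross a x = 0) →
          (∀ i, ∀ x ∈ ((R i).half c).1.extremePoints ℝ, x ≠ 0 → ∃ a ∈ L, cross a x = 0) := by
        intro c hc R hR i x hx hx0
        by_cases hcx : cross c x = 0
        · refine ⟨b, hbL, ?_⟩
          rcases hc with rfl | rfl
          · exact hcx
          · simpa using hcx
        · exact hR i x (extremePoints_inter_cross (R i).convex hx hcx) hx0
      have fin : ∀ R : ι → PolyO 2, C R → (∀ i, (R i).1 ⊆ (Q i).1) →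
          (∀ i, ∀ x ∈ (R i).1.extremePoints ℝ, x ≠ 0 → ∃ a ∈ L, cross a x = 0) →
          ((∀ i, ∀ x ∈ (R i).1, 0 ≤ cross b x) ∨ (∀ i, ∀ x ∈ (R i).1, 0 ≤ cross (-b) x)) →
          F R = 0 := by
        intro R hCR hRQ hRe hRb
        refine ih (fun a ha => hM a (by simp [ha])) R hCR hRe fun a ha haM => ?_
        by_cases hab : a = b
        · subst hab; exact hRb
        · exact (hsgn a ha (by simp [hab, haM])).imp (fun H i x hx => H i x (hRQ i hx))
            (fun H i x hx => H i x (hRQ i hx))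
      have k1 := fin (fun i => (Q i).half b) (hC b Q hb0 hQ) (fun i x hx => hx.1)
        (step b (Or.inl rfl) Q hext) (Or.inl fun i x hx => hx.2)
      have k2 := fin (fun i => (Q i).half (-b)) (hC (-b) Q (neg_ne_zero.2 hb0) hQ)
        (fun i x hx => hx.1) (step (-b) (Or.inr rfl) Q hext) (Or.inr fun i x hx => hx.2)
      have k3 := fin (fun i => ((Q i).half b).half (-b))
        (hC (-b) _ (neg_ne_zero.2 hb0) (hC b Q hb0 hQ)) (fun i x hx => hx.1.1)
        (step (-b) (Or.inr rfl) _ (step b (Or.inl rfl) Q hext)) (Or.inl fun i x hx => hx.1.2)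
      have := hF b Q hb0
      rwa [k1, k2, k3, add_zero, add_zero] at this
  refine main L (fun a ha => ha) P hP (fun i x hx hx0 => ⟨x, ?_, cross_self x⟩)
    (fun a ha haL => absurd ha haL)
  simp only [hL, List.mem_cons, List.mem_filter, decide_eq_true_eq]
  refine Or.inr (Or.inr ⟨?_, hx0⟩)
  rw [Finset.mem_toList, Set.Finite.mem_toFinset]
  exact Set.mem_iUnion.2 ⟨i, hx⟩

/-! ### Cut additivity and the valuation property -/

/-- Additivity under cuts by lines through the origin. -/
def IsCutAdditive {V : Type*} [Add V] (F : PolyO 2 → V) : Prop :=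
  ∀ (a : E 2) (P : PolyO 2), a ≠ 0 →
    F P + F ((P.half a).half (-a)) = F (P.half a) + F (P.half (-a))

theorem IsValuation.isCutAdditive {Z : PolyO 2 → E 2} (hZ : IsValuation Z) : IsCutAdditive Z := by
  intro a P _
  refine (hZ _ _ _ _ ?_ ?_).symm
  · ext x
    have := le_total 0 (cross a x)
    simp only [Set.mem_union, PolyO.mem_half, cross_neg_left, neg_nonneg]
    tauto
  · ext x
    simp only [Set.mem_inter_iff, PolyO.mem_half]
    tauto

/-- If neither triangle contains the other, each is longer on one of the rays. The midpoint of the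
two longer tips then lies outside both triangles, contradicting convexity of the union. -/
theorem tri_subset_or_subset {v w : E 2} (hvw : 0 < cross v w) {s t s' t' : ℝ} (hs : 0 ≤ s)
    (ht : 0 ≤ t) (hs' : 0 ≤ s') (ht' : 0 ≤ t')
    (hconv : Convex ℝ ((tri (s • v) (t • w)).1 ∪ (tri (s' • v) (t' • w)).1)) :
    (tri (s • v) (t • w)).1 ⊆ (tri (s' • v) (t' • w)).1 ∨
      (tri (s' • v) (t' • w)).1 ⊆ (tri (s • v) (t • w)).1 := by
  have mono : ∀ {s t s' t' : ℝ}, 0 ≤ s → 0 ≤ t → s ≤ s' → t ≤ t' →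
      (tri (s • v) (t • w)).1 ⊆ (tri (s' • v) (t' • w)).1 := by
    intro s t s' t' hs ht hss htt
    have aux : ∀ {P : PolyO 2} {r r' : ℝ} {u : E 2}, 0 ≤ r → r ≤ r' → r' • u ∈ P.1 →
        r • u ∈ P.1 := by
      intro P r r' u hr hrr hu
      rcases (hr.trans hrr).eq_or_lt with h0 | h0
      · have : r = 0 := by linarith
        rw [this, zero_smul]; exact P.2.2
      · have := P.smul_mem hu (t := r / r') (by positivity) ((div_le_one h0).2 hrr)
        rwa [smul_smul, div_mul_cancel₀ _ h0.ne'] at this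
    refine convexHull_min ?_ (tri (s' • v) (t' • w)).convex
    rintro z (rfl | rfl | rfl)
    · exact (tri _ _).2.2
    · exact aux hs hss (left_mem_tri _ _)
    · exact aux ht htt (right_mem_tri _ _)
  have coord : ∀ {a b c d : ℝ}, a • v + b • w = c • v + d • w → a = c ∧ b = d := by
    intro a b c d h
    constructor
    · have := congrArg (fun x => cross x w) h
      simp only [cross_add_left, cross_smul_left, cross_self, mul_zero, add_zero] at this
      exact mul_right_cancel₀ hvw.ne' this
    · have := congrArg (fun x => cross v x) h
      simp only [cross_add_right, cross_smul_right, cross_self, mul_zero, zero_add] at this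
      exact mul_right_cancel₀ hvw.ne' this
  rcases le_or_gt s s' with h1 | h1 <;> rcases le_or_gt t t' with h2 | h2
  · exact Or.inl (mono hs ht h1 h2)
  · rcases h1.eq_or_lt with rfl | h1
    · exact Or.inr (mono hs' ht' le_rfl h2.le)
    exfalso
    have hm := hconv (Or.inr (left_mem_tri (s' • v) (t' • w)))
      (Or.inl (right_mem_tri (s • v) (t • w))) (a := 1 / 2) (b := 1 / 2) (by norm_num)
      (by norm_num) (by norm_num)
    rw [smul_smul, smul_smul] at hm
    rcases hm with hm | hm
    · obtain ⟨x, y, hx, hy, hxy, e⟩ := mem_tri.1 hm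
      rw [smul_smul, smul_smul] at e
      obtain ⟨e1, e2⟩ := coord e
      have : y = 1 / 2 := mul_right_cancel₀ (by linarith : t ≠ 0) e2.symm
      nlinarith
    · obtain ⟨x, y, hx, hy, hxy, e⟩ := mem_tri.1 hm
      rw [smul_smul, smul_smul] at e
      obtain ⟨e1, e2⟩ := coord e
      have : x = 1 / 2 := mul_right_cancel₀ (by linarith : s' ≠ 0) e1.symm
      nlinarith
  · rcases h2.eq_or_lt with rfl | h2
    · exact Or.inr (mono hs' ht' h1.le le_rfl)
    exfalso
    have hm := hconv (Or.inl (left_mem_tri (s • v) (t • w)))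
      (Or.inr (right_mem_tri (s' • v) (t' • w))) (a := 1 / 2) (b := 1 / 2) (by norm_num)
      (by norm_num) (by norm_num)
    rw [smul_smul, smul_smul] at hm
    rcases hm with hm | hm
    · obtain ⟨x, y, hx, hy, hxy, e⟩ := mem_tri.1 hm
      rw [smul_smul, smul_smul] at e
      obtain ⟨e1, e2⟩ := coord e
      have : x = 1 / 2 := mul_right_cancel₀ (by linarith : s ≠ 0) e1.symm
      nlinarith
    · obtain ⟨x, y, hx, hy, hxy, e⟩ := mem_tri.1 hm
      rw [smul_smul, smul_smul] at e
      obtain ⟨e1, e2⟩ := coord e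
      have : y = 1 / 2 := mul_right_cancel₀ (by linarith : t' ≠ 0) e2.symm
      nlinarith
  · exact Or.inr (mono hs' ht' h1.le h2.le)

/-- Additivity under cuts by lines through the origin implies the valuation property. -/
theorem IsCutAdditive.isValuation {Z : PolyO 2 → E 2} (hZ : IsCutAdditive Z) : IsValuation Z := by
  intro P Q U I hU hI
  -- The defect of the valuation identity is treated as a cut-additive function of four polytopes,
  -- restricted to quadruples whose last two members are the union and the intersection of the first
  -- two; cuts preserve this restriction.
  have := eq_zero_of_cut (ι := Fin 4) (fun R => Z (R 0) + Z (R 1) - Z (R 2) - Z (R 3)) ?_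
    (fun R => (R 2).1 = (R 0).1 ∪ (R 1).1 ∧ (R 3).1 = (R 0).1 ∩ (R 1).1) ?_ ?_ ![P, Q, U, I]
    ⟨hU, hI⟩
  · rw [sub_sub, sub_eq_zero] at this
    exact this
  · intro a R ha
    have e0 := hZ a (R 0) ha
    have e1 := hZ a (R 1) ha
    have e2 := hZ a (R 2) ha
    have e3 := hZ a (R 3) ha
    have e := congrArg₂ (· - ·) (congrArg₂ (· - ·) (congrArg₂ (· + ·) e0 e1) e2) e3
    dsimp only at e ⊢
    convert e using 1 <;> abel
  · rintro a R - ⟨h1, h2⟩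
    constructor
    · ext x
      have := Set.ext_iff.1 h1 x
      simp only [Set.mem_union, PolyO.mem_half] at *
      tauto
    · ext x
      have := Set.ext_iff.1 h2 x
      simp only [Set.mem_inter_iff, PolyO.mem_half] at *
      tauto
  · rintro R v w ⟨h1, h2⟩ hvw hR
    obtain ⟨s, t, hs, ht, e0⟩ := hR 0
    obtain ⟨s', t', hs', ht', e1⟩ := hR 1
    have hc := (R 2).convex
    rw [h1, e0, e1] at hc
    have := tri_subset_or_subset hvw hs ht hs' ht' hc
    rw [← e0, ← e1] at this
    rcases this with hsub | hsub
    · have e2 : R 2 = R 1 := PolyO.ext (h1.trans (Set.union_eq_right.2 hsub))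
      have e3 : R 3 = R 0 := PolyO.ext (h2.trans (Set.inter_eq_left.2 hsub))
      rw [e2, e3]; abel
    · have e2 : R 2 = R 0 := PolyO.ext (h1.trans (Set.union_eq_left.2 hsub))
      have e3 : R 3 = R 1 := PolyO.ext (h2.trans (Set.inter_eq_right.2 hsub))
      rw [e2, e3]; abel

/-- A cut-additive function is determined by its values on triangles with a vertex at the origin
and on segments with an end at the origin. -/
theorem IsCutAdditive.eq_zero {V : Type*} [AddCommGroup V] {F : PolyO 2 → V}
    (hF : IsCutAdditive F) (h2 : ∀ v w : E 2, 0 < cross v w → F (tri v w) = 0)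
    (h1 : ∀ v : E 2, F (tri v 0) = 0) (P : PolyO 2) : F P = 0 := by
  refine eq_zero_of_cut (ι := Unit) (fun R => F (R ())) (fun a R ha => hF a (R ()) ha)
    (fun _ => True) (fun _ _ _ _ => trivial) ?_ (fun _ => P) trivial
  intro R v w _ hvw hR
  obtain ⟨s, t, hs, ht, e⟩ := hR ()
  simp only [e]
  rcases hs.eq_or_lt with rfl | hs
  · rw [zero_smul, tri_comm]; exact h1 _
  rcases ht.eq_or_lt with rfl | ht
  · rw [zero_smul]; exact h1 _
  refine h2 _ _ ?_
  rw [cross_smul_left, cross_smul_right]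
  positivity

end Cut

section Measure

/-! ### Volume and moment vector -/

open MeasureTheory

theorem volume_eq_zero_of_cross {S : Set (E 2)} {d : E 2} (hd : d ≠ 0)
    (h : ∀ p ∈ S, cross d p = 0) : volume S = 0 := by
  have hne : Submodule.span ℝ {d} ≠ ⊤ := by
    intro htop
    have h1 := finrank_span_singleton (K := ℝ) hd
    rw [htop, finrank_top, finrank_euclideanSpace_fin] at h1
    omega
  refine measure_mono_null (fun p hp => ?_) (Measure.addHaar_submodule volume _ hne)
  obtain ⟨t, rfl⟩ := exists_smul_of_cross_eq_zero hd (h p hp)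
  exact Submodule.smul_mem _ t (Submodule.mem_span_singleton_self d)

theorem exists_cross_eq_zero (v : E 2) : ∃ d : E 2, d ≠ 0 ∧ ∀ t : ℝ, cross d (t • v) = 0 := by
  rcases eq_or_ne v 0 with rfl | hv
  · refine ⟨!₂[1, 0], fun h => ?_, fun t => by simp⟩
    simpa using congrArg (fun x : E 2 => x 0) h
  · exact ⟨v, hv, fun t => by rw [cross_smul_right, cross_self, mul_zero]⟩

/-- The standard triangle. -/
def stdTri : PolyO 2 := tri !₂[1, 0] !₂[0, 1]

theorem mem_stdTri {x : E 2} : x ∈ stdTri.1 ↔ 0 ≤ x 0 ∧ 0 ≤ x 1 ∧ x 0 + x 1 ≤ 1 := by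
  rw [stdTri, mem_tri_iff (by simp [cross])]
  simp [cross]

/-- The matrix with columns `v` and `w`. -/
def frame (v w : E 2) : Matrix (Fin 2) (Fin 2) ℝ := !![v 0, w 0; v 1, w 1]

theorem det_frame (v w : E 2) : (frame v w).det = cross v w := by
  simp [frame, Matrix.det_fin_two, cross]; ring

theorem act_frame (v w x : E 2) : act (frame v w) x = x 0 • v + x 1 • w := by
  refine ext_coord ?_ ?_
  · simp [act_apply_zero, frame]; ring
  · simp [act_apply_one, frame]; ring

theorem image_frame_stdTri (v w : E 2) : act (frame v w) '' stdTri.1 = (tri v w).1 := by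
  change act (frame v w) '' (convexHull ℝ {0, !₂[1, 0], !₂[0, 1]}) = convexHull ℝ {0, v, w}
  rw [LinearMap.image_convexHull, Set.image_insert_eq, Set.image_pair, map_zero]
  simp [act_frame]

theorem det_act (A : Matrix (Fin 2) (Fin 2) ℝ) : LinearMap.det (act A) = A.det := by
  rw [act, Matrix.toEuclideanLin_eq_toLin_orthonormal]
  exact LinearMap.det_toLin _ _

theorem volume_tri (v w : E 2) :
    volume (tri v w).1 = ENNReal.ofReal |cross v w| * volume stdTri.1 := by
  rw [← image_frame_stdTri, Measure.addHaar_image_linearMap, det_act, det_frame]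

theorem PolyO.measurableSet {n : ℕ} (P : PolyO n) : MeasurableSet P.1 :=
  P.isCompact.isClosed.measurableSet

theorem PolyO.volume_ne_top {n : ℕ} (P : PolyO n) : volume P.1 ≠ ⊤ := P.isCompact.measure_ne_top

/-- This gives positivity of both `stdArea` and `stdMoment`. Their exact values never matter, since
they are absorbed into `ζ` and `c₁`. -/
theorem stdTri_interior_pos : 0 < volume (stdTri.1 ∩ {x | 0 < x 0}) := by
  have hopen : IsOpen {x : E 2 | 0 < x 0 ∧ 0 < x 1 ∧ x 0 + x 1 < 1} :=
    IsOpen.and (isOpen_lt (by fun_prop) (by fun_prop))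
      (IsOpen.and (isOpen_lt (by fun_prop) (by fun_prop)) (isOpen_lt (by fun_prop) (by fun_prop)))
  refine (hopen.measure_pos volume ⟨!₂[1 / 4, 1 / 4], by norm_num⟩).trans_le (measure_mono ?_)
  rintro x ⟨h0, h1, h2⟩
  exact ⟨mem_stdTri.2 ⟨h0.le, h1.le, h2.le⟩, h0⟩

/-- The area of the standard triangle. -/
def stdArea : ℝ≥0 := (volume stdTri.1).toNNReal

theorem stdArea_pos : 0 < stdArea :=
  ENNReal.toNNReal_pos (stdTri_interior_pos.trans_le (measure_mono Set.inter_subset_left)).ne'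
    stdTri.volume_ne_top

theorem toNNReal_volume_tri {v w : E 2} (h : 0 < cross v w) :
    (volume (tri v w).1).toNNReal = (cross v w).toNNReal * stdArea := by
  rw [volume_tri, ENNReal.toNNReal_mul, abs_of_pos h]
  rfl

theorem momentVector_isValuation : IsValuation fun P : PolyO 2 => momentVector P.1 := by
  intro P Q U I hU hI
  have hint : ∀ R : PolyO 2, IntegrableOn (fun x : E 2 => x) R.1 := fun R =>
    continuous_id.continuousOn.integrableOn_compact R.isCompact
  simp only [momentVector, hU, hI]
  have h1 := integral_inter_add_sdiff Q.measurableSet (hint P)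
  have h2 : ∫ x in P.1 ∪ Q.1, x = (∫ x in P.1 \ Q.1, x) + ∫ x in Q.1, x := by
    rw [← setIntegral_union Set.disjoint_sdiff_left Q.measurableSet
      ((hint P).mono_set Set.sdiff_subset) (hint Q), Set.sdiff_union_self]
  rw [← h1, h2]
  abel

theorem momentVector_tri_zero (v : E 2) : momentVector (tri v 0).1 = 0 := by
  have : volume (tri v 0).1 = 0 := by
    obtain ⟨d, hd, hdv⟩ := exists_cross_eq_zero v
    refine volume_eq_zero_of_cross hd fun p hp => ?_
    obtain ⟨s, t, _, _, _, rfl⟩ := mem_tri.1 hp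
    rw [smul_zero, add_zero, hdv]
  rw [momentVector, setIntegral_measure_zero _ this]

theorem momentVector_image {v w : E 2} (h : cross v w ≠ 0) (P : PolyO 2) :
    momentVector (act (frame v w) '' P.1)
      = |cross v w| • act (frame v w) (momentVector P.1) := by
  set f : E 2 →L[ℝ] E 2 := LinearMap.toContinuousLinearMap (act (frame v w)) with hf
  have hdet : f.det = cross v w := by
    rw [← det_frame, ← det_act]; rfl
  have hinj : Function.Injective f := by
    intro x y hxy
    have hxy' : act (frame v w) x = act (frame v w) y := hxy
    rw [act_frame, act_frame] at hxy'
    refine ext_coord ?_ ?_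
    · have := congrArg (fun z => cross z w) hxy'
      simp only [cross_add_left, cross_smul_left, cross_self, mul_zero, add_zero] at this
      exact mul_right_cancel₀ h this
    · have := congrArg (fun z => cross v z) hxy'
      simp only [cross_add_right, cross_smul_right, cross_self, mul_zero, zero_add] at this
      exact mul_right_cancel₀ h this
  have := integral_image_eq_integral_abs_det_fderiv_smul volume P.measurableSet
    (fun x _ => f.hasFDerivAt.hasFDerivWithinAt) (hinj.injOn (s := P.1)) (fun x => x)
  rw [hdet] at this
  change ∫ x in f '' P.1, x = |cross v w| • f (∫ x in P.1, x)
  rw [this, integral_smul, f.integral_comp_comm]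
  exact continuous_id.continuousOn.integrableOn_compact P.isCompact

/-- The first coordinate of the moment vector of the standard triangle. -/
def stdMoment : ℝ := momentVector stdTri.1 0

theorem stdMoment_pos : 0 < stdMoment := by
  have hint : IntegrableOn (fun x : E 2 => x) stdTri.1 :=
    continuous_id.continuousOn.integrableOn_compact stdTri.isCompact
  have e : stdMoment = ∫ x in stdTri.1, x 0 := by
    have := (EuclideanSpace.proj (𝕜 := ℝ) (0 : Fin 2)).integral_comp_comm (E := E 2) hint
    exact this.symm
  rw [e, setIntegral_pos_iff_support_of_nonneg_ae]
  · refine stdTri_interior_pos.trans_le (measure_mono ?_)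
    rintro x ⟨hx, hx0⟩
    exact ⟨ne_of_gt hx0, hx⟩
  · rw [Filter.EventuallyLE, ae_restrict_iff' stdTri.measurableSet]
    exact Filter.Eventually.of_forall fun x hx => (mem_stdTri.1 hx).1
  · exact (by fun_prop : Continuous fun x : E 2 => x 0).continuousOn.integrableOn_compact
      stdTri.isCompact

/-- Exchanging the coordinates maps the standard triangle to itself. -/
theorem momentVector_stdTri_one : momentVector stdTri.1 1 = stdMoment := by
  have h : cross !₂[0, 1] !₂[1, 0] = -1 := by simp [cross]
  have := momentVector_image (v := !₂[0, 1]) (w := !₂[1, 0]) (by rw [h]; norm_num) stdTri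
  rw [image_frame_stdTri, tri_comm, h, act_frame] at this
  have h2 := congrArg (fun x : E 2 => x 1) this
  simpa [stdMoment, stdTri] using h2

theorem momentVector_tri {v w : E 2} (h : 0 < cross v w) :
    momentVector (tri v w).1 = (cross v w * stdMoment) • (v + w) := by
  rw [← image_frame_stdTri, momentVector_image h.ne', act_frame, momentVector_stdTri_one,
    abs_of_pos h, ← stdMoment]
  module

/-! ### The facet vector -/

theorem isGreatest_supportFn {n : ℕ} (P : PolyO n) (u : E n) :
    IsGreatest ((fun x => inner ℝ x u) '' P.1) (supportFn P.1 u) :=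
  (P.isCompact.image (by fun_prop : Continuous fun x : E n => inner ℝ x u)).isGreatest_sSup
    ⟨_, 0, P.2.2, rfl⟩

theorem inner_le_supportFn {n : ℕ} (P : PolyO n) (u : E n) {x : E n} (hx : x ∈ P.1) :
    inner ℝ x u ≤ supportFn P.1 u := (isGreatest_supportFn P u).2 ⟨x, hx, rfl⟩

theorem supportFn_nonneg {n : ℕ} (P : PolyO n) (u : E n) : 0 ≤ supportFn P.1 u := by
  simpa using inner_le_supportFn P u P.2.2

theorem face_nonempty {n : ℕ} (P : PolyO n) (u : E n) : (face P.1 u).Nonempty := by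
  obtain ⟨x, hx, h⟩ := (isGreatest_supportFn P u).1
  exact ⟨x, hx, h⟩

theorem supportFn_eq {n : ℕ} {P : PolyO n} {u : E n} {h : ℝ} {x : E n} (hx : x ∈ P.1)
    (hxh : inner ℝ x u = h) (hle : ∀ y ∈ P.1, inner ℝ y u ≤ h) : supportFn P.1 u = h := by
  obtain ⟨y, hy, e⟩ := (isGreatest_supportFn P u).1
  refine le_antisymm ?_ (hxh ▸ inner_le_supportFn P u hx)
  rw [← e]; exact hle y hy

theorem face_convex {n : ℕ} (P : PolyO n) (u : E n) : Convex ℝ (face P.1 u) := by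
  intro x hx y hy a b ha hb hab
  refine ⟨P.convex hx.1 hy.1 ha hb hab, ?_⟩
  rw [inner_add_left, real_inner_smul_left, real_inner_smul_left, hx.2, hy.2, ← add_mul, hab,
    one_mul]

theorem mem_convexHull_insert_zero {F : Set (E 2)} (hF : Convex ℝ F) {p : E 2} :
    p ∈ convexHull ℝ (insert 0 F) ↔ p = 0 ∨ ∃ t : ℝ, 0 < t ∧ t ≤ 1 ∧ ∃ f ∈ F, p = t • f := by
  rcases F.eq_empty_or_nonempty with rfl | hne
  · simp
  rw [convexHull_insert hne, hF.convexHull_eq, mem_convexJoin]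
  constructor
  · rintro ⟨_, rfl, f, hf, ⟨a, t, ha, ht, hat, rfl⟩⟩
    rcases ht.eq_or_lt with h | h
    · left; simp [← h]
    · exact Or.inr ⟨t, h, by linarith, f, hf, by simp⟩
  · rintro (rfl | ⟨t, ht, ht1, f, hf, rfl⟩)
    · obtain ⟨f, hf⟩ := hne
      exact ⟨0, rfl, f, hf, left_mem_segment ℝ 0 f⟩
    · exact ⟨0, rfl, f, hf, 1 - t, t, by linarith, ht.le, by ring, by simp⟩

/-- The volume of the cone with apex at the origin over a set. -/
def coneVol (F : Set (E 2)) : ℝ≥0 := (volume (convexHull ℝ (insert 0 F))).toNNReal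

theorem coneVol_eq_zero {F : Set (E 2)} {d : E 2} (hd : d ≠ 0) (h : ∀ p ∈ F, cross d p = 0) :
    coneVol F = 0 := by
  have : volume (convexHull ℝ (insert 0 F)) = 0 := by
    refine volume_eq_zero_of_cross hd fun p hp => ?_
    have hc : Convex ℝ {p | cross d p = 0} := by
      intro x hx y hy a b _ _ _
      simp only [Set.mem_ofPred_eq, cross_add_right, cross_smul_right] at *
      rw [hx, hy]; ring
    refine convexHull_min ?_ hc hp
    rintro x (rfl | hx)
    · simp
    · exact h x hx
  rw [coneVol, this, ENNReal.toNNReal_zero]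

/-- The boundary of the half plane passes through the apex, so cutting `F` cuts its cone in the same
way; the two halves overlap only in a null set on the line. -/
theorem coneVol_add {F : Set (E 2)} (hF : Convex ℝ F) (hfin : volume (convexHull ℝ (insert 0 F)) ≠ ⊤)
    {a : E 2} (ha : a ≠ 0) :
    coneVol F = coneVol (F ∩ {x | 0 ≤ cross a x}) + coneVol (F ∩ {x | 0 ≤ cross (-a) x}) := by
  have hinter : ∀ b : E 2, convexHull ℝ (insert 0 (F ∩ {x | 0 ≤ cross b x}))
      = convexHull ℝ (insert 0 F) ∩ {x | 0 ≤ cross b x} := by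
    intro b
    ext p
    rw [mem_convexHull_insert_zero (convex_inter_cross hF b), Set.mem_inter_iff,
      mem_convexHull_insert_zero hF]
    constructor
    · rintro (rfl | ⟨t, ht, ht1, f, ⟨hf, hfb⟩, rfl⟩)
      · exact ⟨Or.inl rfl, by simp⟩
      · refine ⟨Or.inr ⟨t, ht, ht1, f, hf, rfl⟩, ?_⟩
        change 0 ≤ cross b (t • f)
        rw [cross_smul_right]
        exact mul_nonneg ht.le hfb
    · rintro ⟨rfl | ⟨t, ht, ht1, f, hf, rfl⟩, hp⟩
      · exact Or.inl rfl
      · refine Or.inr ⟨t, ht, ht1, f, ⟨hf, ?_⟩, rfl⟩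
        change 0 ≤ cross b (t • f) at hp
        rw [cross_smul_right] at hp
        exact nonneg_of_mul_nonneg_right hp ht
  unfold coneVol
  rw [hinter a, hinter (-a), ← ENNReal.toNNReal_add]
  · congr 1
    rw [← measure_inter_add_sdiff _ (isClosed_cross_nonneg a).measurableSet]
    congr 1
    refine measure_congr (Filter.EventuallyEq.symm ?_)
    refine (ae_eq_set.2 ⟨?_, ?_⟩)
    · refine volume_eq_zero_of_cross ha fun p hp => ?_
      obtain ⟨⟨hp1, hp2⟩, hp3⟩ := hp
      have h2 : 0 ≤ cross (-a) p := hp2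
      rw [cross_neg_left] at h2
      have h3 : 0 ≤ cross a p := by
        by_contra h; exact hp3 ⟨hp1, h⟩
      linarith
    · refine measure_mono_null (t := ∅) ?_ (by simp)
      rintro p ⟨⟨hp1, hp2⟩, hp3⟩
      refine hp3 ⟨hp1, ?_⟩
      have h2 : ¬ 0 ≤ cross a p := hp2
      change 0 ≤ cross (-a) p
      rw [cross_neg_left]; linarith
  · exact ne_top_of_le_ne_top hfin (measure_mono Set.inter_subset_left)
  · exact ne_top_of_le_ne_top hfin (measure_mono Set.inter_subset_left)

theorem coneVolume_eq_coneVol (P : Set (E 2)) (u : E 2) : coneVolume P u = coneVol (face P u) := rfl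

open Classical in
/-- The contribution of the direction `u` to the facet vector. -/
def facetTerm (ζ : ℝ≥0 → ℝ) (P : Set (E 2)) (u : E 2) : E 2 :=
  if ‖u‖ = 1 then (ζ (coneVolume P u) / supportFn P u) • u else 0

theorem IsCauchySolution.map_zero {ζ : ℝ≥0 → ℝ} (hζ : IsCauchySolution ζ) : ζ 0 = 0 := by
  have := hζ 0 0
  rw [add_zero] at this
  linarith

/-- A face lies in a line orthogonal to `u`, so its dimension is at most one. A single point has a
null cone, and an affine hull through the origin would make the support function vanish. -/
theorem mem_normals_of_coneVolume_ne_zero (P : PolyO 2) {u : E 2} (hu : ‖u‖ = 1)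
    (hV : coneVolume P.1 u ≠ 0) (hh : supportFn P.1 u ≠ 0) : u ∈ normals P.1 \ normalsO P.1 := by
  have hu0 : u ≠ 0 := by rintro rfl; simp at hu
  have hle : vectorSpan ℝ (face P.1 u) ≤ Submodule.span ℝ {quarter u} := by
    rw [vectorSpan, Submodule.span_le]
    rintro _ ⟨x, hx, y, hy, rfl⟩
    have e : cross (quarter u) (x - y) = 0 := by
      have : cross (quarter u) (x - y) = -inner ℝ (x - y) u := by
        simp [PiLp.inner_apply, Fin.sum_univ_two, cross]; ring
      rw [this, inner_sub_left, hx.2, hy.2, sub_self, neg_zero]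
    have hq : quarter u ≠ 0 := by
      intro h
      have := cross_quarter_self_pos hu0
      rw [h, cross_zero_right] at this
      exact lt_irrefl _ this
    obtain ⟨t, ht⟩ := exists_smul_of_cross_eq_zero hq e
    change x - y ∈ Submodule.span ℝ {quarter u}
    rw [ht]
    exact Submodule.smul_mem _ t (Submodule.mem_span_singleton_self _)
  have h1 : dim (face P.1 u) ≤ 1 :=
    (Submodule.finrank_mono hle).trans ((finrank_span_le_card _).trans (by simp))
  have h2 : dim (face P.1 u) ≠ 0 := by
    intro h
    apply hV
    obtain ⟨x, hx⟩ := face_nonempty P u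
    obtain ⟨d, hd, hdx⟩ := exists_cross_eq_zero x
    refine coneVol_eq_zero hd fun y hy => ?_
    rw [dim, Submodule.finrank_eq_zero] at h
    have := vsub_mem_vectorSpan ℝ hy hx
    rw [h, Submodule.mem_bot, vsub_eq_sub, sub_eq_zero] at this
    rw [this]; simpa using hdx 1
  refine ⟨⟨hu, face_nonempty P u, by omega⟩, fun hO => hh ?_⟩
  have hsub : ∀ p ∈ affineSpan ℝ (face P.1 u), inner ℝ p u = supportFn P.1 u := by
    intro p hp
    refine affineSpan_induction hp (fun x hx => hx.2) ?_
    intro c x y z hx hy hz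
    simp only [vsub_eq_sub, vadd_eq_add, inner_add_left, real_inner_smul_left, inner_sub_left, hx,
      hy, hz]
    ring
  have := hsub 0 hO.2
  rw [inner_zero_left] at this
  exact this.symm

theorem facetTerm_eq_zero {ζ : ℝ≥0 → ℝ} (hζ : ζ 0 = 0) (P : PolyO 2) {u : E 2}
    (hu : u ∉ normals P.1 \ normalsO P.1) : facetTerm ζ P.1 u = 0 := by
  unfold facetTerm
  split_ifs with h
  · by_cases hh : supportFn P.1 u = 0
    · rw [hh, div_zero, zero_smul]
    by_cases hV : coneVolume P.1 u = 0
    · rw [hV, hζ, zero_div, zero_smul]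
    exact absurd (mem_normals_of_coneVolume_ne_zero P h hV hh) hu
  · rfl

/-- Directions outside the index set contribute nothing: either the cone is null and `ζ 0 = 0`, or
the support function is `0` and division by zero yields `0`. Summing over all vectors lets
additivity be checked one direction at a time. The absolute value disappears because `o ∈ P`. -/
theorem facetVector_eq_finsum {ζ : ℝ≥0 → ℝ} (hζ : ζ 0 = 0) (P : PolyO 2) :
    facetVector ζ P.1 = ∑ᶠ u, facetTerm ζ P.1 u := by
  rw [facetVector, finsum_mem_def]
  refine finsum_congr fun u => ?_
  by_cases hu : u ∈ normals P.1 \ normalsO P.1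
  · rw [Set.indicator_of_mem hu, facetTerm, if_pos hu.1.1, abs_of_nonneg (supportFn_nonneg P u)]
  · rw [Set.indicator_of_notMem hu, facetTerm_eq_zero hζ P hu]

theorem finite_support_facetTerm {ζ : ℝ≥0 → ℝ} (hζ : ζ 0 = 0) (P : PolyO 2) :
    (Function.support (facetTerm ζ P.1)).Finite := by
  refine (normals_finite P.1 P.2.1).subset fun u hu => ?_
  by_contra h
  exact hu (facetTerm_eq_zero hζ P fun h' => h h'.1)

/-- If the half plane meets the face, the support function is unchanged and the face is merely cut.
Otherwise the new face lies on the cutting line, so both cones are null. -/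
theorem div_supportFn_half {ζ : ℝ≥0 → ℝ} (hζ : ζ 0 = 0) (P : PolyO 2) {a : E 2} (ha : a ≠ 0)
    {u : E 2} :
    ζ (coneVolume (P.half a).1 u) / supportFn (P.half a).1 u
      = ζ (coneVol (face P.1 u ∩ {x | 0 ≤ cross a x})) / supportFn P.1 u := by
  by_cases hne : (face P.1 u ∩ {x | 0 ≤ cross a x}).Nonempty
  · obtain ⟨x, hx, hxa⟩ := hne
    have hs : supportFn (P.half a).1 u = supportFn P.1 u :=
      supportFn_eq (P := P.half a) ⟨hx.1, hxa⟩ hx.2 fun y hy => inner_le_supportFn P u hy.1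
    have hf : face (P.half a).1 u = face P.1 u ∩ {x | 0 ≤ cross a x} := by
      ext y
      unfold face
      rw [hs]
      simp only [Set.mem_ofPred_eq, Set.mem_inter_iff, PolyO.mem_half]
      tauto
    rw [hs, coneVolume_eq_coneVol, hf]
  · have hlt : supportFn (P.half a).1 u < supportFn P.1 u := by
      obtain ⟨y, hy, hyu⟩ := face_nonempty (P.half a) u
      refine lt_of_le_of_ne (hyu ▸ inner_le_supportFn P u hy.1) fun e => hne ⟨y, ⟨hy.1, ?_⟩, hy.2⟩
      rw [hyu, e]
    have h0 : coneVolume (P.half a).1 u = 0 := by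
      refine coneVol_eq_zero ha fun y hy => ?_
      by_contra hya
      have hypos : 0 < cross a y := lt_of_le_of_ne hy.1.2 (Ne.symm hya)
      obtain ⟨p, hp, hpu⟩ := face_nonempty P u
      have hM : 0 < cross a y + |cross a p| := by positivity
      -- A point `y` of the new face off the cutting line could be moved a little towards a
      -- maximiser `p` of `P` without leaving the half plane, which would increase the height.
      set δ := cross a y / (cross a y + |cross a p|) with hδ
      have hδ0 : 0 < δ := by positivity
      have hδ1 : δ ≤ 1 := by rw [hδ, div_le_one hM]; linarith [abs_nonneg (cross a p)]
      have hmem : (1 - δ) • y + δ • p ∈ (P.half a).1 :=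
        ⟨P.convex hy.1.1 hp (by linarith) hδ0.le (by ring), by
          change 0 ≤ cross a ((1 - δ) • y + δ • p)
          rw [cross_add_right, cross_smul_right, cross_smul_right]
          have e : (1 - δ) * cross a y + δ * cross a p = δ * (|cross a p| + cross a p) := by
            rw [hδ]; field_simp; ring
          rw [e]
          exact mul_nonneg hδ0.le (by linarith [neg_abs_le (cross a p)])⟩
      have := inner_le_supportFn (P.half a) u hmem
      rw [inner_add_left, real_inner_smul_left, real_inner_smul_left, hpu, hy.2] at this
      nlinarith
    rw [Set.not_nonempty_iff_eq_empty] at hne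
    rw [h0, hne, coneVol_eq_zero ha (by simp), hζ, zero_div, zero_div]

theorem facetTerm_half {ζ : ℝ≥0 → ℝ} (hζ : IsCauchySolution ζ) (P : PolyO 2) {a : E 2}
    (ha : a ≠ 0) (u : E 2) :
    facetTerm ζ P.1 u = facetTerm ζ (P.half a).1 u + facetTerm ζ (P.half (-a)).1 u := by
  unfold facetTerm
  split_ifs with hu
  -- If the support function of `P` vanishes at `u`, so do those of both halves, and all three
  -- quotients are `0`.
  · rcases (supportFn_nonneg P u).eq_or_lt with h | h
    · have h0 : ∀ b : E 2, supportFn (P.half b).1 u = 0 := by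
        intro b
        refine le_antisymm ?_ (supportFn_nonneg _ u)
        obtain ⟨y, hy, hyu⟩ := face_nonempty (P.half b) u
        rw [h, ← hyu]; exact inner_le_supportFn P u hy.1
      simp [h0, ← h]
    · rw [div_supportFn_half hζ.map_zero P ha,
        div_supportFn_half hζ.map_zero P (neg_ne_zero.2 ha), ← add_smul, ← add_div, ← hζ,
        ← coneVol_add (face_convex P u) ?_ ha, coneVolume_eq_coneVol]
      refine ne_top_of_le_ne_top P.volume_ne_top (measure_mono (convexHull_min ?_ P.convex))
      rintro x (rfl | hx)
      exacts [P.2.2, hx.1]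
  · rw [add_zero]

theorem facetVector_eq_zero_of_line {ζ : ℝ≥0 → ℝ} (hζ : ζ 0 = 0) (P : PolyO 2) {d : E 2}
    (hd : d ≠ 0) (h : ∀ p ∈ P.1, cross d p = 0) : facetVector ζ P.1 = 0 := by
  rw [facetVector_eq_finsum hζ]
  have : ∀ u, facetTerm ζ P.1 u = 0 := by
    intro u
    have hV : coneVolume P.1 u = 0 := coneVol_eq_zero hd fun p hp => h p hp.1
    rw [facetTerm, hV, hζ, zero_div, zero_smul, ite_self]
  simp only [this, finsum_zero]

theorem facetVector_isCutAdditive {ζ : ℝ≥0 → ℝ} (hζ : IsCauchySolution ζ) :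
    IsCutAdditive fun P : PolyO 2 => facetVector ζ P.1 := by
  intro a P ha
  have h0 : facetVector ζ ((P.half a).half (-a)).1 = 0 :=
    facetVector_eq_zero_of_line hζ.map_zero _ ha fun p hp =>
      le_antisymm (by simpa using hp.2) hp.1.2
  simp only [h0, add_zero]
  rw [facetVector_eq_finsum hζ.map_zero, facetVector_eq_finsum hζ.map_zero,
    facetVector_eq_finsum hζ.map_zero,
    ← finsum_add_distrib (finite_support_facetTerm hζ.map_zero _)
      (finite_support_facetTerm hζ.map_zero _)]
  exact finsum_congr fun u => facetTerm_half hζ P ha u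

theorem facetVector_tri_zero {ζ : ℝ≥0 → ℝ} (hζ : ζ 0 = 0) (v : E 2) :
    facetVector ζ (tri v 0).1 = 0 := by
  obtain ⟨d, hd, hdv⟩ := exists_cross_eq_zero v
  refine facetVector_eq_zero_of_line hζ _ hd fun p hp => ?_
  obtain ⟨s, t, _, _, _, rfl⟩ := mem_tri.1 hp
  rw [smul_zero, add_zero, hdv]

/-- If `v` misses the positive maximum, the face lies on the ray through `w` and its cone is null.
-/
theorem coneVolume_tri_eq_zero {v w u : E 2} (hpos : 0 < supportFn (tri v w).1 u)
    (hlt : inner ℝ v u < supportFn (tri v w).1 u) : coneVolume (tri v w).1 u = 0 := by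
  obtain ⟨d, hd, hdw⟩ := exists_cross_eq_zero w
  refine coneVol_eq_zero hd fun p hp => ?_
  obtain ⟨s, t, hs, ht, hst, rfl⟩ := mem_tri.1 hp.1
  have hw := inner_le_supportFn (tri v w) u (right_mem_tri v w)
  have e := hp.2
  rw [inner_add_left, real_inner_smul_left, real_inner_smul_left] at e
  have hs0 : s = 0 := by
    by_contra hne
    have : 0 < s := lt_of_le_of_ne hs (Ne.symm hne)
    nlinarith
  rw [hs0, zero_smul, zero_add, hdw]

/-- Only the edge from `v` to `w` contributes, as the other two pass through the origin. Its outer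
normal is `q = ρ(v - w)`, with `⟨v, q⟩ = ⟨w, q⟩ = cross v w`, and its cone is the whole triangle.
The length of `q` cancels between the height and the unit normal. -/
theorem facetVector_tri {ζ : ℝ≥0 → ℝ} (hζ : ζ 0 = 0) {v w : E 2} (h : 0 < cross v w) :
    facetVector ζ (tri v w).1
      = (ζ ((cross v w).toNNReal * stdArea) / cross v w) • quarter (v - w) := by
  set q := quarter (v - w) with hq
  have hqv : inner ℝ v q = cross v w := by
    rw [real_inner_comm, inner_quarter, cross_swap, cross_sub_right]; simp
  have hqw : inner ℝ w q = cross v w := by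
    rw [real_inner_comm, inner_quarter]; simp [cross]; ring
  have hq0 : 0 < ‖q‖ := by
    rw [norm_pos_iff]
    intro h0
    rw [h0, inner_zero_right] at hqv
    exact h.ne hqv
  set u₀ := ‖q‖⁻¹ • q with hu₀
  have hu₀n : ‖u₀‖ = 1 := by
    rw [hu₀, norm_smul, norm_inv, norm_norm, inv_mul_cancel₀ hq0.ne']
  have hv₀ : inner ℝ v u₀ = cross v w / ‖q‖ := by
    rw [hu₀, real_inner_smul_right, hqv]; field_simp
  have hw₀ : inner ℝ w u₀ = cross v w / ‖q‖ := by
    rw [hu₀, real_inner_smul_right, hqw]; field_simp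
  have hquot : 0 < cross v w / ‖q‖ := by positivity
  have hsupp : supportFn (tri v w).1 u₀ = cross v w / ‖q‖ := by
    refine supportFn_eq (left_mem_tri v w) hv₀ fun y hy => ?_
    obtain ⟨s, t, hs, ht, hst, rfl⟩ := mem_tri.1 hy
    rw [inner_add_left, real_inner_smul_left, real_inner_smul_left, hv₀, hw₀]
    nlinarith
  have hcone : coneVolume (tri v w).1 u₀ = (cross v w).toNNReal * stdArea := by
    rw [← toNNReal_volume_tri h, coneVolume]
    congr 2
    refine Set.Subset.antisymm (convexHull_min ?_ (tri v w).convex) (convexHull_mono ?_)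
    · rintro x (rfl | hx)
      exacts [(tri v w).2.2, hx.1]
    · rintro x (rfl | rfl | rfl)
      · exact Set.mem_insert _ _
      · exact Set.mem_insert_of_mem _ ⟨left_mem_tri _ _, by rw [hv₀, hsupp]⟩
      · exact Set.mem_insert_of_mem _ ⟨right_mem_tri _ _, by rw [hw₀, hsupp]⟩
  rw [facetVector_eq_finsum hζ, finsum_eq_single _ u₀]
  · rw [facetTerm, if_pos hu₀n, hcone, hsupp, hu₀, smul_smul]
    congr 1; field_simp
  · intro u hu
    unfold facetTerm
    split_ifs with hn
    swap
    · rfl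
    rcases (supportFn_nonneg (tri v w) u).eq_or_lt with hh | hh
    · rw [← hh, div_zero, zero_smul]
    by_cases hV : coneVolume (tri v w).1 u = 0
    · rw [hV, hζ, zero_div, zero_smul]
    exfalso
    have e1 : inner ℝ v u = supportFn (tri v w).1 u :=
      (inner_le_supportFn _ u (left_mem_tri v w)).eq_of_not_lt fun hlt =>
        hV (coneVolume_tri_eq_zero hh hlt)
    have e2 : inner ℝ w u = supportFn (tri v w).1 u :=
      (inner_le_supportFn _ u (right_mem_tri v w)).eq_of_not_lt fun hlt => by
        rw [tri_comm] at hlt hh hV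
        exact hV (coneVolume_tri_eq_zero hh hlt)
    -- Both ends attain the maximum, so the system `⟨v, u⟩ = ⟨w, u⟩ = m` determines `u` by Cramer's
    -- rule.
    obtain ⟨k, hk, hku⟩ : ∃ k : ℝ, 0 < k ∧ u = k • q := by
      refine ⟨supportFn (tri v w).1 u / cross v w, by positivity, ?_⟩
      set m := supportFn (tri v w).1 u
      simp only [PiLp.inner_apply, Fin.sum_univ_two, RCLike.inner_apply, conj_trivial] at e1 e2
      refine ext_coord ?_ ?_ <;>
        simp only [hq, PiLp.smul_apply, smul_eq_mul, quarter_apply_zero, quarter_apply_one,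
          PiLp.sub_apply] <;> rw [div_mul_eq_mul_div, eq_div_iff h.ne'] <;> unfold cross
      · linear_combination w 1 * e1 - v 1 * e2
      · linear_combination v 0 * e2 - w 0 * e1
    apply hu
    rw [hku, norm_smul, Real.norm_of_nonneg hk.le] at hn
    rw [hku, hu₀, ← eq_inv_of_mul_eq_one_left hn]

end Measure

/-! ### The vector `e(P)` as a sum over boundary rays of the cone spanned by `P` -/

/-- `x` is the last point of `P` on a ray that bounds the cone spanned by `P`; the sign of `ε` says
on which side. -/
def IsTip (ε : ℝ) (P : Set (E 2)) (x : E 2) : Prop :=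
  x ≠ 0 ∧ x ∈ P ∧ (∀ t : ℝ, t • x ∈ P → t ≤ 1) ∧ ∀ p ∈ P, 0 ≤ ε * cross x p

theorem IsTip.eq_of_smul {ε : ℝ} {P : Set (E 2)} {x y : E 2} (hx : IsTip ε P x) (hy : IsTip ε P y)
    {t : ℝ} (ht : 0 < t) (h : y = t • x) : y = x := by
  have h1 : t ≤ 1 := hx.2.2.1 t (h ▸ hy.2.1)
  have h2 : t⁻¹ ≤ 1 := hy.2.2.1 t⁻¹ (by
    rw [h, smul_smul, inv_mul_cancel₀ ht.ne', one_smul]; exact hx.2.1)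
  have h3 : t = 1 := le_antisymm h1 ((inv_le_one₀ ht).1 h2)
  rw [h, h3, one_smul]

theorem IsTip.exists_smul {ε : ℝ} (hε : ε ≠ 0) {P : Set (E 2)} {x y : E 2} (hx : IsTip ε P x)
    (hy : IsTip ε P y) : ∃ t : ℝ, y = t • x := by
  have h1 := hx.2.2.2 y hy.2.1
  have h2 := hy.2.2.2 x hx.2.1
  rw [cross_swap] at h2
  have : ε * cross x y = 0 := by linarith
  exact exists_smul_of_cross_eq_zero hx.1 ((mul_eq_zero.1 this).resolve_left hε)

/-- All tips of one sign are parallel, and each of the two directions on their line carries at most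
one. -/
theorem finite_setOf_isTip {ε : ℝ} (hε : ε ≠ 0) (P : Set (E 2)) : {x | IsTip ε P x}.Finite := by
  rcases Set.eq_empty_or_nonempty {x | IsTip ε P x} with h | ⟨x, hx⟩
  · rw [h]; exact Set.finite_empty
  have hsub : {y | IsTip ε P y} \ {x} |>.Subsingleton := by
    have key : ∀ y, IsTip ε P y → y ≠ x → ∃ t : ℝ, t < 0 ∧ y = t • x := by
      intro y hy hyx
      obtain ⟨t, ht⟩ := hx.exists_smul hε hy
      refine ⟨t, ?_, ht⟩
      by_contra! h
      rcases h.eq_or_lt with h | h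
      · rw [← h, zero_smul] at ht; exact hy.1 ht
      · exact hyx (hx.eq_of_smul hy h ht)
    rintro y ⟨hy, hyx⟩ z ⟨hz, hzx⟩
    obtain ⟨s, hs, rfl⟩ := key y hy hyx
    obtain ⟨t, ht, rfl⟩ := key z hz hzx
    refine (IsTip.eq_of_smul hy hz (t := t / s) (div_pos_of_neg_of_neg ht hs) ?_).symm
    rw [smul_smul, div_mul_cancel₀ _ hs.ne]
  refine (hsub.finite.union (Set.finite_singleton x)).subset fun y hy => ?_
  by_cases h : y = x
  · exact Or.inr h
  · exact Or.inl ⟨hy, h⟩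

open Classical in
/-- The sum of the tips of `P` on one side. -/
def tipSum (ε : ℝ) (P : Set (E 2)) : E 2 := ∑ᶠ x, if IsTip ε P x then x else 0

theorem finite_support_tip {ε : ℝ} (hε : ε ≠ 0) (P : Set (E 2)) [DecidablePred (IsTip ε P)] :
    (Function.support fun x => if IsTip ε P x then x else 0).Finite := by
  refine (finite_setOf_isTip hε P).subset fun x hx => ?_
  by_contra h
  exact hx (if_neg h)

/-- Off the cutting line the condition is local at `x`: moving `p` along the segment towards `x`
brings it into the half plane and only scales `cross x p` by a positive factor. -/
theorem isTip_half_of_pos {ε : ℝ} {P : PolyO 2} {a x : E 2} (hx : 0 < cross a x) :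
    IsTip ε (P.half a).1 x ↔ IsTip ε P.1 x := by
  constructor
  · rintro ⟨h0, h1, h2, h3⟩
    refine ⟨h0, h1.1, fun t ht => ?_, fun p hp => ?_⟩
    · by_contra! h
      exact absurd (h2 t ⟨ht, by
        change 0 ≤ cross a (t • x)
        rw [cross_smul_right]; nlinarith⟩) (not_le.2 h)
    · have hM : 0 < cross a x + |cross a p| := by positivity
      set δ := cross a x / (cross a x + |cross a p|) with hδ
      have hδ0 : 0 < δ := by positivity
      have hδ1 : δ ≤ 1 := by rw [hδ, div_le_one hM]; linarith [abs_nonneg (cross a p)]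
      have := h3 ((1 - δ) • x + δ • p) ⟨P.convex h1.1 hp (by linarith) hδ0.le (by ring), by
        change 0 ≤ cross a ((1 - δ) • x + δ • p)
        rw [cross_add_right, cross_smul_right, cross_smul_right]
        have e : (1 - δ) * cross a x + δ * cross a p = δ * (|cross a p| + cross a p) := by
          rw [hδ]; field_simp; ring
        rw [e]
        exact mul_nonneg hδ0.le (by linarith [neg_abs_le (cross a p)])⟩
      rw [cross_add_right, cross_smul_right, cross_smul_right, cross_self, mul_zero, zero_add,
        mul_left_comm] at this
      exact nonneg_of_mul_nonneg_right this hδ0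
  · rintro ⟨h0, h1, h2, h3⟩
    exact ⟨h0, ⟨h1, hx.le⟩, fun t ht => h2 t ht.1, fun p hp => h3 p hp.1⟩

theorem not_isTip_half_of_neg {ε : ℝ} {P : PolyO 2} {a x : E 2} (hx : cross a x < 0) :
    ¬ IsTip ε (P.half a).1 x := fun h => absurd h.2.1.2 (not_le.2 hx)

theorem isTip_half_of_eq {ε : ℝ} {P : PolyO 2} {a x : E 2} (hx : cross a x = 0) :
    IsTip ε (P.half a).1 x ↔ x ≠ 0 ∧ x ∈ P.1 ∧ (∀ t : ℝ, t • x ∈ P.1 → t ≤ 1) ∧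
      ∀ p ∈ P.1, 0 ≤ cross a p → 0 ≤ ε * cross x p := by
  have hmem : ∀ t : ℝ, t • x ∈ (P.half a).1 ↔ t • x ∈ P.1 := fun t =>
    ⟨fun h => h.1, fun h => ⟨h, by
      change 0 ≤ cross a (t • x)
      rw [cross_smul_right, hx, mul_zero]⟩⟩
  have h1 := hmem 1
  rw [one_smul] at h1
  unfold IsTip
  simp only [hmem, h1, PolyO.mem_half, and_imp]

/-- The identity holds for each candidate `x` separately. Off the cutting line, `x` is seen only by
`P` and one half. If `x` is the last point of `P` on its ray within the cutting line, it is a tip of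
the intersection and, by sign, of one half automatically; for the other half, being a tip is
equivalent to being a tip of `P`. -/
theorem tipSum_isCutAdditive {ε : ℝ} (hε : ε ≠ 0) :
    IsCutAdditive fun P : PolyO 2 => tipSum ε P.1 := by
  classical
  intro a P ha
  unfold tipSum
  rw [← finsum_add_distrib (finite_support_tip hε _) (finite_support_tip hε _),
    ← finsum_add_distrib (finite_support_tip hε _) (finite_support_tip hε _)]
  refine finsum_congr fun x => ?_
  rcases lt_trichotomy (cross a x) 0 with h | h | h
  · have h' : 0 < cross (-a) x := by simpa using h
    have n0 : ¬ IsTip ε ((P.half a).half (-a)).1 x := by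
      rw [isTip_half_of_pos h']; exact not_isTip_half_of_neg h
    rw [if_neg n0, if_neg (not_isTip_half_of_neg h), add_zero, zero_add]
    simp only [isTip_half_of_pos h']
  · by_cases hT : x ≠ 0 ∧ x ∈ P.1 ∧ (∀ t : ℝ, t • x ∈ P.1 → t ≤ 1)
    · obtain ⟨hx0, hxP, hxt⟩ := hT
      have h' : cross (-a) x = 0 := by simpa using h
      obtain ⟨c, rfl⟩ := exists_smul_of_cross_eq_zero ha h
      have hc : c ≠ 0 := by rintro rfl; simp at hx0
      have hq : ∀ p, ε * cross (c • a) p = (ε * c) * cross a p := fun p => by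
        rw [cross_smul_left]; ring
      have k0 : IsTip ε ((P.half a).half (-a)).1 (c • a) := by
        rw [isTip_half_of_eq h']
        refine ⟨hx0, ⟨hxP, h.ge⟩, fun t ht => hxt t ht.1, fun p hp hp' => ?_⟩
        have : cross a p = 0 := le_antisymm (by simpa using hp') hp.2
        rw [hq, this, mul_zero]
      have kP : IsTip ε P.1 (c • a) ↔ ∀ p ∈ P.1, 0 ≤ (ε * c) * cross a p := by
        unfold IsTip
        simp only [hq]
        exact ⟨fun h => h.2.2.2, fun h => ⟨hx0, hxP, hxt, h⟩⟩
      have kp : IsTip ε (P.half a).1 (c • a) ↔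
          ∀ p ∈ P.1, 0 ≤ cross a p → 0 ≤ (ε * c) * cross a p := by
        rw [isTip_half_of_eq h]
        simp only [hq]
        exact ⟨fun h => h.2.2.2, fun h => ⟨hx0, hxP, hxt, h⟩⟩
      have km : IsTip ε (P.half (-a)).1 (c • a) ↔
          ∀ p ∈ P.1, cross a p ≤ 0 → 0 ≤ (ε * c) * cross a p := by
        rw [isTip_half_of_eq h']
        simp only [hq, cross_neg_left, neg_nonneg]
        exact ⟨fun h => h.2.2.2, fun h => ⟨hx0, hxP, hxt, h⟩⟩
      rw [if_pos k0]
      rcases lt_or_gt_of_ne (mul_ne_zero hε hc) with hs | hs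
      · rw [if_pos (km.2 fun p _ hp => mul_nonneg_of_nonpos_of_nonpos hs.le hp), add_left_inj]
        have : IsTip ε P.1 (c • a) ↔ IsTip ε (P.half a).1 (c • a) := by
          rw [kP, kp]
          refine ⟨fun H p hp _ => H p hp, fun H p hp => ?_⟩
          rcases le_total 0 (cross a p) with h | h
          · exact H p hp h
          · exact mul_nonneg_of_nonpos_of_nonpos hs.le h
        simp only [this]
      · rw [if_pos (kp.2 fun p _ hp => mul_nonneg hs.le hp), add_comm, add_right_inj]
        have : IsTip ε P.1 (c • a) ↔ IsTip ε (P.half (-a)).1 (c • a) := by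
          rw [kP, km]
          refine ⟨fun H p hp _ => H p hp, fun H p hp => ?_⟩
          rcases le_total 0 (cross a p) with h | h
          · exact mul_nonneg hs.le h
          · exact H p hp h
        simp only [this]
    · have h' : cross (-a) x = 0 := by simpa using h
      have n : ∀ b : E 2, cross b x = 0 → ¬ IsTip ε (P.half b).1 x := fun b hb H => by
        rw [isTip_half_of_eq hb] at H
        exact hT ⟨H.1, H.2.1, H.2.2.1⟩
      have n0 : ¬ IsTip ε ((P.half a).half (-a)).1 x := fun H => by
        rw [isTip_half_of_eq h'] at H
        refine hT ⟨H.1, H.2.1.1, fun t ht => H.2.2.1 t ⟨ht, ?_⟩⟩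
        change 0 ≤ cross a (t • x)
        rw [cross_smul_right, h, mul_zero]
      rw [if_neg (fun H => hT ⟨H.1, H.2.1, H.2.2.1⟩), if_neg n0, if_neg (n a h), if_neg (n _ h')]
  · have h' : cross (-a) x < 0 := by simpa using h
    rw [if_neg (not_isTip_half_of_neg h'), if_neg (not_isTip_half_of_neg h')]
    simp only [isTip_half_of_pos h]

theorem tipSum_eq_zero {ε : ℝ} {P : Set (E 2)} (h : ∀ x, ¬ IsTip ε P x) : tipSum ε P = 0 := by
  unfold tipSum
  simp only [h, if_false, finsum_zero]

theorem tipSum_eq {ε : ℝ} {P : Set (E 2)} {v : E 2} (hv : IsTip ε P v)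
    (h : ∀ x, IsTip ε P x → x = v) : tipSum ε P = v := by
  unfold tipSum
  rw [finsum_eq_single _ v fun x hx => if_neg fun H => hx (h x H), if_pos hv]

/-! ### Tips and edges -/

theorem segment_eq_of_ray {P : Set (E 2)} (hP : Convex ℝ P) {v w : E 2} (hv : v ∈ P) (hw : w ∈ P)
    {d : E 2} {s t : ℝ} (hvs : v = s • d) (hwt : w = t • d)
    (hmax : ∀ r : ℝ, r • d ∈ P → s ≤ r ∧ r ≤ t) (hd : d ≠ 0) :
    segment ℝ v w = P ∩ {x | cross d x = 0} := by
  refine Set.Subset.antisymm (fun x hx => ⟨hP.segment_subset hv hw hx, ?_⟩) ?_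
  · obtain ⟨a, b, _, _, _, rfl⟩ := hx
    simp [hvs, hwt, cross_add_right, cross_smul_right]
  · rintro x ⟨hx, hxd⟩
    obtain ⟨r, rfl⟩ := exists_smul_of_cross_eq_zero hd hxd
    obtain ⟨h1, h2⟩ := hmax r hx
    rcases (h1.trans h2).eq_or_lt with h | h
    · have : r = s := le_antisymm (by linarith) h1
      rw [this, ← hvs]; exact left_mem_segment ℝ v w
    · refine ⟨(t - r) / (t - s), (r - s) / (t - s), div_nonneg (by linarith) (by linarith),
        div_nonneg (by linarith) (by linarith), ?_, ?_⟩
      · have : t - s ≠ 0 := by linarith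
        field_simp; ring
      · have : t - s ≠ 0 := by linarith
        rw [hvs, hwt, smul_smul, smul_smul, ← add_smul]; congr 1; field_simp; ring

/-- The points of `P` on a supporting line form an extreme subset. -/
theorem isExtreme_inter_line {P : Set (E 2)} {ε : ℝ} (hε : ε ≠ 0) {d : E 2}
    (h : ∀ p ∈ P, 0 ≤ ε * cross d p) : IsExtreme ℝ P (P ∩ {x | cross d x = 0}) := by
  refine ⟨Set.inter_subset_left, ?_⟩
  rintro x hx y hy z ⟨-, hz⟩ ⟨a, b, ha, hb, hab, rfl⟩
  refine ⟨hx, ?_⟩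
  simp only [Set.mem_ofPred_eq, cross_add_right, cross_smul_right] at hz ⊢
  have h1 := h x hx
  have h2 := h y hy
  have e : a * (ε * cross d x) + b * (ε * cross d y) = 0 := by linear_combination ε * hz
  have h3 : ε * cross d x = 0 := by
    have := mul_nonneg ha.le h1
    have := mul_nonneg hb.le h2
    have h4 : a * (ε * cross d x) = 0 := by linarith
    exact (mul_eq_zero.1 h4).resolve_left ha.ne'
  exact (mul_eq_zero.1 h3).resolve_left hε

/-- If the intersection of `P` with a line through the origin is extreme, the line supports `P`. -/
theorem cross_sign_of_isExtreme (P : PolyO 2) {F : Set (E 2)} (hF : IsExtreme ℝ P.1 F) {d : E 2}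
    (hFd : ∀ x ∈ F, cross d x = 0)
    (hPd : ∀ c : ℝ, c • d ∈ P.1 → c • d ∈ F) :
    (∀ p ∈ P.1, 0 ≤ cross d p) ∨ (∀ p ∈ P.1, cross d p ≤ 0) := by
  by_contra! h
  obtain ⟨⟨p, hp, hp'⟩, q, hq, hq'⟩ := h
  have hd : d ≠ 0 := by rintro rfl; simp at hp'
  have hD : 0 < cross d q - cross d p := by linarith
  set a := cross d q / (cross d q - cross d p) with ha
  set b := -cross d p / (cross d q - cross d p) with hb
  have ha0 : 0 < a := by positivity
  have hb0 : 0 < b := div_pos (by linarith) hD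
  have hab : a + b = 1 := by rw [ha, hb]; field_simp; ring
  have hx : a • p + b • q ∈ P.1 := P.convex hp hq ha0.le hb0.le hab
  have hx0 : cross d (a • p + b • q) = 0 := by
    rw [cross_add_right, cross_smul_right, cross_smul_right, ha, hb]; field_simp; ring
  obtain ⟨c, hc⟩ := exists_smul_of_cross_eq_zero hd hx0
  have := hF.left_mem_of_mem_openSegment hp hq (hPd c (hc ▸ hx)) ⟨a, b, ha0, hb0, hab, hc⟩
  exact absurd (hFd _ this) hp'.ne

theorem PolyO.exists_max_smul (P : PolyO 2) {d : E 2} (hd : d ≠ 0) :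
    ∃ t : ℝ, t • d ∈ P.1 ∧ ∀ r : ℝ, r • d ∈ P.1 → r ≤ t := by
  have hK : IsCompact (P.1 ∩ {x | cross d x = 0}) :=
    P.isCompact.inter_right (isClosed_eq (continuous_cross d) continuous_const)
  obtain ⟨q, hq, hqmax⟩ := hK.exists_isMaxOn ⟨0, P.2.2, by simp⟩
    (continuous_cross (-quarter d)).continuousOn
  obtain ⟨t, rfl⟩ := exists_smul_of_cross_eq_zero hd hq.2
  refine ⟨t, hq.1, fun r hr => ?_⟩
  have h1 := hqmax (show r • d ∈ P.1 ∩ {x | cross d x = 0} from ⟨hr, by simp [cross_smul_right]⟩)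
  have hpos := cross_quarter_self_pos hd
  rw [cross_swap] at hpos
  simp only [Set.mem_ofPred_eq, cross_smul_right, cross_neg_left] at h1
  exact le_of_mul_le_mul_right (by linarith) hpos

theorem dim_le_one_of_cross {P : Set (E 2)} {d : E 2} (h0 : (0 : E 2) ∈ P) (hd : d ≠ 0)
    (h : ∀ p ∈ P, cross d p = 0) : dim P ≤ 1 := by
  have hle : vectorSpan ℝ P ≤ Submodule.span ℝ {d} := by
    rw [vectorSpan_eq_span_vsub_set_right ℝ h0, Submodule.span_le]
    rintro _ ⟨p, hp, rfl⟩
    obtain ⟨t, rfl⟩ := exists_smul_of_cross_eq_zero hd (h p hp)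
    simpa using Submodule.smul_mem _ t (Submodule.mem_span_singleton_self d)
  exact (Submodule.finrank_mono hle).trans (finrank_span_singleton hd).le

theorem exists_cross_ne_zero {P : Set (E 2)} (h0 : (0 : E 2) ∈ P) (hdim : dim P = 2) {d : E 2}
    (hd : d ≠ 0) : ∃ p ∈ P, cross d p ≠ 0 := by
  by_contra! h
  have := dim_le_one_of_cross h0 hd h
  omega

theorem dim_eq_two_of_cross {P : Set (E 2)} (h0 : (0 : E 2) ∈ P) {v w : E 2} (hv : v ∈ P)
    (hw : w ∈ P) (h : cross v w ≠ 0) : dim P = 2 := by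
  have : vectorSpan ℝ P = ⊤ := by
    rw [eq_top_iff]
    intro x _
    rw [eq_smul_add_smul h x]
    have aux : ∀ y ∈ P, y ∈ vectorSpan ℝ P := fun y hy => by
      simpa using vsub_mem_vectorSpan ℝ hy h0
    exact add_mem (Submodule.smul_mem _ _ (aux v hv)) (Submodule.smul_mem _ _ (aux w hw))
  rw [dim, this, finrank_top, finrank_euclideanSpace_fin]

theorem dim_eq_one_of_cross {P : Set (E 2)} (h0 : (0 : E 2) ∈ P) {d : E 2} (hd : d ≠ 0)
    (hdP : d ∈ P) (h : ∀ p ∈ P, cross d p = 0) : dim P = 1 := by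
  refine le_antisymm (dim_le_one_of_cross h0 hd h) ?_
  have hle : Submodule.span ℝ {d} ≤ vectorSpan ℝ P := by
    rw [Submodule.span_le, Set.singleton_subset_iff]
    simpa using vsub_mem_vectorSpan ℝ hdP h0
  exact (finrank_span_singleton hd).symm.le.trans (Submodule.finrank_mono hle)

theorem IsTip.unique {ε : ℝ} (hε : ε ≠ 0) {P : Set (E 2)} (h0 : (0 : E 2) ∈ P) (hdim : dim P = 2)
    {x y : E 2} (hx : IsTip ε P x) (hy : IsTip ε P y) : y = x := by
  obtain ⟨t, ht⟩ := hx.exists_smul hε hy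
  rcases lt_trichotomy t 0 with h | h | h
  · obtain ⟨p, hp, hne⟩ := exists_cross_ne_zero h0 hdim hx.1
    have h1 := hx.2.2.2 p hp
    have h2 := hy.2.2.2 p hp
    rw [ht, cross_smul_left] at h2
    have : ε * cross x p ≠ 0 := mul_ne_zero hε hne
    have h3 : 0 < ε * cross x p := lt_of_le_of_ne h1 this.symm
    nlinarith
  · rw [h, zero_smul] at ht
    exact absurd ht hy.1
  · exact hx.eq_of_smul hy h ht

/-- Extremality of the segment prevents `P` from extending beyond `v` and makes the line through the
edge a supporting line. -/
theorem isTip_of_isEdge (P : PolyO 2) {v : E 2} (hv : IsEdge P.1 0 v) :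
    IsTip 1 P.1 v ∨ IsTip (-1) P.1 v := by
  have hvP : v ∈ P.1 := hv.2.1 (right_mem_segment ℝ 0 v)
  have hseg : ∀ t : ℝ, t • v ∈ segment ℝ 0 v → t ≤ 1 := by
    rintro t ⟨a, b, ha, hb, hab, e⟩
    rw [smul_zero, zero_add] at e
    have : (b - t) • v = 0 := by rw [sub_smul, e, sub_self]
    have := (smul_eq_zero.1 this).resolve_right hv.1.symm
    linarith
  have hmax : ∀ t : ℝ, t • v ∈ P.1 → t ≤ 1 := by
    intro t ht
    by_contra! h
    refine absurd (hseg t (hv.2.right_mem_of_mem_openSegment P.2.2 ht (right_mem_segment ℝ 0 v)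
      ⟨1 - t⁻¹, t⁻¹, sub_pos.2 (inv_lt_one_of_one_lt₀ h), by positivity, by ring, ?_⟩))
      (not_le.2 h)
    rw [smul_zero, zero_add, smul_smul, inv_mul_cancel₀ (by positivity), one_smul]
  have hsgn := cross_sign_of_isExtreme P hv.2 (d := v) ?_ ?_
  · rcases hsgn with h | h
    · exact Or.inl ⟨hv.1.symm, hvP, hmax, fun p hp => by rw [one_mul]; exact h p hp⟩
    · exact Or.inr ⟨hv.1.symm, hvP, hmax, fun p hp => by linarith [h p hp]⟩
  · rintro x ⟨a, b, _, _, _, rfl⟩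
    simp [cross_smul_right]
  · intro c hc
    rcases le_or_gt 0 c with h | h
    · exact ⟨1 - c, c, by linarith [hmax c hc], h, by ring, by simp⟩
    · refine hv.2.left_mem_of_mem_openSegment hc hvP (left_mem_segment ℝ 0 v)
        ⟨1 / (1 - c), -c / (1 - c), ?_, ?_, ?_, ?_⟩
      · exact div_pos one_pos (by linarith)
      · exact div_pos (by linarith) (by linarith)
      · have : 1 - c ≠ 0 := by linarith
        field_simp; ring
      · have : 1 - c ≠ 0 := by linarith
        rw [smul_smul, ← add_smul]
        convert zero_smul ℝ v using 2
        field_simp; ring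

/-- The ends point in opposite directions, so the one supporting line gives them opposite signs. -/
theorem isTip_of_isEdge_of_mem_openSegment (P : PolyO 2) {v w : E 2} (hvw : IsEdge P.1 v w)
    (h0 : 0 ∈ openSegment ℝ v w) :
    (IsTip 1 P.1 v ∧ IsTip (-1) P.1 w) ∨ (IsTip (-1) P.1 v ∧ IsTip 1 P.1 w) := by
  have hvP : v ∈ P.1 := hvw.2.1 (left_mem_segment ℝ v w)
  have hwP : w ∈ P.1 := hvw.2.1 (right_mem_segment ℝ v w)
  obtain ⟨a, b, ha, hb, hab, e⟩ := h0
  obtain ⟨k, hk, rfl⟩ : ∃ k : ℝ, 0 < k ∧ w = (-k) • v := by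
    refine ⟨a / b, by positivity, ?_⟩
    have e2 : b • w = (-a) • v := by rw [neg_smul]; exact eq_neg_of_add_eq_zero_right e
    rw [← one_smul ℝ w, ← inv_mul_cancel₀ hb.ne', mul_smul, e2, smul_smul]
    congr 1; field_simp
  have hv0 : v ≠ 0 := by rintro rfl; exact hvw.1 (by simp)
  have hw0 : (-k) • v ≠ 0 := smul_ne_zero (neg_ne_zero.2 hk.ne') hv0
  have hseg : ∀ t : ℝ, t • v ∈ segment ℝ v ((-k) • v) ↔ -k ≤ t ∧ t ≤ 1 := by
    intro t
    constructor
    · rintro ⟨c, d, hc, hd, hcd, e⟩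
      have : (c + d * (-k) - t) • v = 0 := by
        rw [sub_smul, ← e]; module
      have := (smul_eq_zero.1 this).resolve_right hv0
      constructor <;> nlinarith
    · rintro ⟨h1, h2⟩
      have hk1 : 0 < 1 + k := by linarith
      refine ⟨(t + k) / (1 + k), (1 - t) / (1 + k), div_nonneg (by linarith) hk1.le,
        div_nonneg (by linarith) hk1.le, by field_simp; ring, ?_⟩
      rw [smul_smul, ← add_smul]
      congr 1; field_simp; ring
  have hout : ∀ (x : E 2) (t : ℝ), x ∈ segment ℝ v ((-k) • v) → 1 < t → t • x ∈ P.1 →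
      t • x ∈ segment ℝ v ((-k) • v) := by
    intro x t hx ht htx
    refine hvw.2.right_mem_of_mem_openSegment P.2.2 htx hx
      ⟨1 - t⁻¹, t⁻¹, sub_pos.2 (inv_lt_one_of_one_lt₀ ht), by positivity, by ring, ?_⟩
    rw [smul_zero, zero_add, smul_smul, inv_mul_cancel₀ (by positivity), one_smul]
  have hmaxv : ∀ t : ℝ, t • v ∈ P.1 → t ≤ 1 := by
    intro t ht
    by_contra! h
    linarith [((hseg t).1 (hout v t (left_mem_segment ℝ _ _) h ht)).2]
  have hmaxw : ∀ t : ℝ, t • (-k) • v ∈ P.1 → t ≤ 1 := by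
    intro t ht
    by_contra! h
    have := hout _ t (right_mem_segment ℝ _ _) h ht
    rw [smul_smul] at this
    nlinarith [((hseg _).1 this).1]
  have hsgn := cross_sign_of_isExtreme P hvw.2 (d := v) ?_ ?_
  · rcases hsgn with h | h
    · refine Or.inl ⟨⟨hv0, hvP, hmaxv, fun p hp => ?_⟩, ⟨hw0, hwP, hmaxw, fun p hp => ?_⟩⟩
      · rw [one_mul]; exact h p hp
      · rw [cross_smul_left]; nlinarith [h p hp]
    · refine Or.inr ⟨⟨hv0, hvP, hmaxv, fun p hp => ?_⟩, ⟨hw0, hwP, hmaxw, fun p hp => ?_⟩⟩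
      · linarith [h p hp]
      · rw [cross_smul_left]; nlinarith [h p hp]
  · rintro x ⟨a, b, _, _, _, rfl⟩
    simp only [cross_add_right, cross_smul_right, cross_self]; ring
  · intro c hc
    refine (hseg c).2 ⟨?_, hmaxv c hc⟩
    have := hmaxw (-c / k) (by
      rw [smul_smul]
      have : -c / k * -k = c := by field_simp
      rwa [this])
    rw [div_le_one hk] at this
    linarith

theorem tipSum_segment {ε : ℝ} {v w : E 2} (hvw : v ≠ w) (h0 : (0 : E 2) ∈ segment ℝ v w) :
    tipSum ε (segment ℝ v w) = v + w := by
  classical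
  obtain ⟨a, b, ha, hb, hab, e⟩ := h0
  obtain ⟨d, hd, hvd, hwd⟩ : ∃ d : E 2, d ≠ 0 ∧ v = (-b) • d ∧ w = a • d := by
    have ha' : a = 1 - b := by linarith
    subst ha'
    refine ⟨w - v, sub_ne_zero.2 hvw.symm, ?_, ?_⟩
    · rw [← sub_eq_zero, ← e]; module
    · rw [← sub_eq_zero, ← e]; module
  have hmem : ∀ x, x ∈ segment ℝ v w ↔ ∃ r : ℝ, -b ≤ r ∧ r ≤ a ∧ x = r • d := by
    intro x
    constructor
    · rintro ⟨s, t, hs, ht, hst, rfl⟩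
      refine ⟨s * (-b) + t * a, by nlinarith, by nlinarith, ?_⟩
      rw [hvd, hwd]; module
    · rintro ⟨r, h1, h2, rfl⟩
      have hb' : b = 1 - a := by linarith
      refine ⟨a - r, r + b, by linarith, by linarith, by linarith, ?_⟩
      rw [hvd, hwd, hb']; module
  have hcoord : ∀ {r s : ℝ}, r • d = s • d → r = s := fun {r s} h => smul_left_injective ℝ hd h
  have hpar : ∀ (r : ℝ), ∀ p ∈ segment ℝ v w, 0 ≤ ε * cross (r • d) p := by
    intro r p hp
    obtain ⟨s, -, -, rfl⟩ := (hmem p).1 hp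
    simp [cross_smul_left, cross_smul_right]
  have hv : v ≠ 0 → IsTip ε (segment ℝ v w) v := by
    intro hv0
    refine ⟨hv0, left_mem_segment ℝ v w, fun t ht => ?_, by simpa only [hvd] using hpar (-b)⟩
    obtain ⟨r, h1, h2, e⟩ := (hmem _).1 ht
    rw [hvd, smul_smul] at e
    have hb0 : b ≠ 0 := by rintro rfl; simp [hvd] at hv0
    have := hcoord e
    have hb1 : 0 < b := lt_of_le_of_ne hb hb0.symm
    nlinarith
  have hw : w ≠ 0 → IsTip ε (segment ℝ v w) w := by
    intro hw0
    refine ⟨hw0, right_mem_segment ℝ v w, fun t ht => ?_, by simpa only [hwd] using hpar a⟩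
    obtain ⟨r, h1, h2, e⟩ := (hmem _).1 ht
    rw [hwd, smul_smul] at e
    have ha0 : a ≠ 0 := by rintro rfl; simp [hwd] at hw0
    have := hcoord e
    have ha1 : 0 < a := lt_of_le_of_ne ha ha0.symm
    nlinarith
  have honly : ∀ x, IsTip ε (segment ℝ v w) x → x = v ∨ x = w := by
    rintro x ⟨hx0, hxP, hxmax, -⟩
    obtain ⟨r, h1, h2, rfl⟩ := (hmem x).1 hxP
    rcases lt_trichotomy r 0 with hr | hr | hr
    · have := hxmax (-b / r) (by
        rw [smul_smul, div_mul_cancel₀ _ hr.ne, ← hvd]; exact left_mem_segment ℝ v w)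
      rw [div_le_one_of_neg hr] at this
      left; rw [hvd, le_antisymm h1 this]
    · simp [hr] at hx0
    · have := hxmax (a / r) (by
        rw [smul_smul, div_mul_cancel₀ _ hr.ne', ← hwd]; exact right_mem_segment ℝ v w)
      rw [div_le_one hr] at this
      right; rw [hwd, le_antisymm h2 this]
  -- An end at the origin is not a tip, but its missing contribution is zero anyway.
  have hval : ∀ x, (x ≠ 0 → IsTip ε (segment ℝ v w) x) →
      (if IsTip ε (segment ℝ v w) x then x else 0) = x := by
    intro x hx
    by_cases h : x = 0
    · rw [h, ite_self]
    · rw [if_pos (hx h)]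
  unfold tipSum
  rw [finsum_eq_sum_of_support_subset (s := {v, w}) _ ?_, Finset.sum_pair hvw]
  · convert congrArg₂ (· + ·) (hval v hv) (hval w hw)
  · intro x hx
    have : IsTip ε (segment ℝ v w) x := by
      by_contra h
      exact hx (if_neg h)
    simpa using honly x this

/-- A polytope with nonempty interior that lies on one side of the line spanned by `x` and contains
no point opposite to `x` is bounded by a second ray. -/
theorem exists_opposite_side (P : PolyO 2) {ε : ℝ} {x : E 2}
    (hx : ∀ p ∈ P.1, 0 ≤ ε * cross x p) (hopp : ∀ r : ℝ, r • x ∈ P.1 → 0 ≤ r)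
    (hne : ∃ p ∈ P.1, 0 < ε * cross x p) :
    ∃ y ∈ P.1, 0 < ε * cross x y ∧ ∀ p ∈ P.1, 0 ≤ -ε * cross y p := by
  classical
  obtain ⟨S, hS⟩ := P.2.1
  have hSP : ∀ s ∈ S, s ∈ P.1 := fun s hs => by
    rw [hS]; exact subset_convexHull ℝ _ hs
  have hconv : ∀ z : E 2, Convex ℝ {p | 0 ≤ -ε * cross z p} := by
    intro z p hp q hq s t hs ht _
    simp only [Set.mem_ofPred_eq, cross_add_right, cross_smul_right] at *
    nlinarith [mul_nonneg hs hp, mul_nonneg ht hq]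
  obtain ⟨p0, hp0, hp0'⟩ := hne
  have hT : (S.filter fun s => 0 < ε * cross x s).Nonempty := by
    by_contra h
    rw [Finset.not_nonempty_iff_eq_empty, Finset.filter_eq_empty_iff] at h
    have hsub : P.1 ⊆ {p | 0 ≤ -ε * cross x p} := by
      rw [hS]
      refine convexHull_min (fun s hs => ?_) (hconv x)
      have := h (Finset.mem_coe.1 hs)
      simp only [Set.mem_ofPred_eq]; linarith
    have := hsub hp0
    simp only [Set.mem_ofPred_eq] at this
    linarith
  have hx0 : x ≠ 0 := by rintro rfl; simp at hp0'
  -- The quotient is a positive multiple of the cotangent of the angle from `x` to `s`; its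
  -- minimiser is the generator farthest from `x` in angle.
  obtain ⟨y, hy, hymin⟩ := Finset.exists_min_image _
    (fun s : E 2 => (x 0 * s 0 + x 1 * s 1) / (ε * cross x s)) hT
  rw [Finset.mem_filter] at hy
  refine ⟨y, hSP y hy.1, hy.2, ?_⟩
  have hsub : P.1 ⊆ {p | 0 ≤ -ε * cross y p} := by
    rw [hS]
    refine convexHull_min (fun s hs => ?_) (hconv y)
    have hs' := hSP s (Finset.mem_coe.1 hs)
    simp only [Set.mem_ofPred_eq]
    rcases (hx s hs').eq_or_lt with h | h
    · have hε : ε ≠ 0 := by rintro rfl; simp at hp0'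
      have hxs : cross x s = 0 := (mul_eq_zero.1 h.symm).resolve_left hε
      obtain ⟨r, rfl⟩ := exists_smul_of_cross_eq_zero hx0 hxs
      have hr := hopp r hs'
      rw [cross_smul_right, cross_swap]
      nlinarith [mul_nonneg hr hy.2.le]
    · have hm := hymin s (Finset.mem_filter.2 ⟨hs, h⟩)
      rw [div_le_div_iff₀ hy.2 h] at hm
      have e : (-ε * cross y s) * (x 0 ^ 2 + x 1 ^ 2)
          = (x 0 * s 0 + x 1 * s 1) * (ε * cross x y)
            - (x 0 * y 0 + x 1 * y 1) * (ε * cross x s) := by unfold cross; ring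
      have hpos : 0 < x 0 ^ 2 + x 1 ^ 2 := by
        have := cross_quarter_self_pos hx0
        have e : cross x (quarter x) = x 0 ^ 2 + x 1 ^ 2 := by simp [cross]; ring
        rwa [e] at this
      have : 0 ≤ (-ε * cross y s) * (x 0 ^ 2 + x 1 ^ 2) := by rw [e]; linarith
      exact nonneg_of_mul_nonneg_left this hpos
  exact fun p hp => hsub hp

theorem isEdge_of_isTip (P : PolyO 2) {ε : ℝ} (hε : ε ≠ 0) {x : E 2} (hx : IsTip ε P.1 x)
    (hopp : ∀ r : ℝ, r • x ∈ P.1 → 0 ≤ r) : IsEdge P.1 0 x := by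
  refine ⟨hx.1.symm, ?_⟩
  rw [segment_eq_of_ray P.convex P.2.2 hx.2.1 (d := x) (s := 0) (t := 1) (by simp) (by simp)
    (fun r hr => ⟨hopp r hr, hx.2.2.1 r hr⟩) hx.1]
  exact isExtreme_inter_line hε hx.2.2.2

/-- The line through `x` meets `P` in the segment from `-t x` to `x`. Either `P` is this segment, or
`t = 0` and a second edge at the origin comes from `exists_opposite_side`, or `t > 0` and the
segment is an edge with the origin inside. -/
theorem exists_isEValue_of_isTip (P : PolyO 2) {ε : ℝ} (hε : ε ≠ 0) {x : E 2}
    (hx : IsTip ε P.1 x) : ∃ e, IsEValue P.1 e := by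
  obtain ⟨t, ht, htmax⟩ := P.exists_max_smul (neg_ne_zero.2 hx.1)
  have hbound : ∀ r : ℝ, r • x ∈ P.1 → -t ≤ r ∧ r ≤ 1 := fun r hr =>
    ⟨by linarith [htmax (-r) (by simpa using hr)], hx.2.2.1 r hr⟩
  have hseg : segment ℝ (t • -x) x = P.1 ∩ {p | cross x p = 0} :=
    segment_eq_of_ray P.convex ht hx.2.1 (d := x) (s := -t) (t := 1) (by simp) (by simp)
      hbound hx.1
  have ht0 : 0 ≤ t := htmax 0 (by simpa using P.2.2)
  by_cases hline : ∀ p ∈ P.1, cross x p = 0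
  · refine ⟨_, Or.inr (Or.inr ⟨dim_eq_one_of_cross P.2.2 hx.1 hx.2.1 hline, t • -x, x, ?_, P.2.2,
      rfl⟩)⟩
    rw [hseg]
    exact (Set.inter_eq_left.2 hline).symm
  push Not at hline
  obtain ⟨p, hp, hpx⟩ := hline
  have hdim := dim_eq_two_of_cross P.2.2 hx.2.1 hp hpx
  rcases ht0.eq_or_lt with h | h
  · have hopp : ∀ r : ℝ, r • x ∈ P.1 → 0 ≤ r := fun r hr => by linarith [(hbound r hr).1]
    obtain ⟨y, hy, hxy, hyP⟩ := exists_opposite_side P hx.2.2.2 hopp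
      ⟨p, hp, lt_of_le_of_ne (hx.2.2.2 p hp) (mul_ne_zero hε hpx).symm⟩
    have hy0 : y ≠ 0 := by rintro rfl; simp at hxy
    obtain ⟨s, hs, hsmax⟩ := P.exists_max_smul hy0
    have hs1 : 1 ≤ s := hsmax 1 (by simpa using hy)
    have hs0 : 0 < s := by linarith
    have hytip : IsTip (-ε) P.1 (s • y) := by
      refine ⟨smul_ne_zero hs0.ne' hy0, hs, fun r hr => ?_, fun q hq => ?_⟩
      · rw [smul_smul] at hr
        have := hsmax _ hr
        nlinarith
      · rw [cross_smul_left]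
        nlinarith [mul_nonneg hs0.le (hyP q hq)]
    have hyopp : ∀ r : ℝ, r • s • y ∈ P.1 → 0 ≤ r := by
      intro r hr
      have := hx.2.2.2 _ hr
      rw [cross_smul_right, cross_smul_right] at this
      have h2 : 0 ≤ r * (s * (ε * cross x y)) := by linarith
      exact nonneg_of_mul_nonneg_left h2 (by positivity)
    refine ⟨_, Or.inl ⟨hdim, x, s • y, ?_, isEdge_of_isTip P hε hx hopp,
      isEdge_of_isTip P (neg_ne_zero.2 hε) hytip hyopp, rfl⟩⟩
    intro e
    have : cross x (s • y) = 0 := by rw [← e, cross_self]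
    rw [cross_smul_right] at this
    have h2 : cross x y = 0 := (mul_eq_zero.1 this).resolve_left hs0.ne'
    rw [h2, mul_zero] at hxy
    exact lt_irrefl _ hxy
  · refine ⟨_, Or.inr (Or.inl ⟨hdim, t • -x, x, ⟨?_, ?_⟩, ?_, rfl⟩)⟩
    · intro e
      have : (t + 1) • x = 0 := by
        rw [smul_neg] at e
        rw [add_smul, one_smul]; nth_rw 2 [← e]; simp
      exact hx.1 ((smul_eq_zero.1 this).resolve_left (by linarith))
    · rw [hseg]
      exact isExtreme_inter_line hε hx.2.2.2
    · refine ⟨1 / (1 + t), t / (1 + t), by positivity, by positivity, by field_simp, ?_⟩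
      rw [smul_smul, smul_neg, ← neg_smul, ← add_smul]
      convert zero_smul ℝ x using 2
      field_simp; ring

/-- In dimension two a nonzero case of `e` has exactly one tip of each sign. A segment lies in its
supporting line, so its nonzero ends are tips for both signs, which explains the factor `2`. -/
theorem eVector_eq_tipSum (P : PolyO 2) : eVector P.1 = tipSum 1 P.1 + tipSum (-1) P.1 := by
  by_cases h : ∃ e, IsEValue P.1 e
  · obtain ⟨e, he⟩ := h
    rw [he.eVector_eq P.convex]
    have two : dim P.1 = 2 → ∀ v w : E 2, IsTip 1 P.1 v → IsTip (-1) P.1 w →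
        v + w = tipSum 1 P.1 + tipSum (-1) P.1 := by
      intro hdim v w hv hw
      rw [tipSum_eq hv fun x hx => hv.unique one_ne_zero P.2.2 hdim hx,
        tipSum_eq hw fun x hx => hw.unique (by norm_num) P.2.2 hdim hx]
    rcases he with ⟨hdim, v, w, hvw, hv, hw, rfl⟩ | ⟨hdim, v, w, hvw, h0, rfl⟩ |
      ⟨hdim, v, w, hvw, h0, rfl⟩
    · rcases isTip_of_isEdge P hv with h1 | h1 <;> rcases isTip_of_isEdge P hw with h2 | h2
      · exact absurd (h2.unique one_ne_zero P.2.2 hdim h1) hvw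
      · exact two hdim v w h1 h2
      · rw [add_comm v w]; exact two hdim w v h2 h1
      · exact absurd (h2.unique (by norm_num) P.2.2 hdim h1) hvw
    · rcases isTip_of_isEdge_of_mem_openSegment P hvw h0 with ⟨h1, h2⟩ | ⟨h1, h2⟩
      · exact two hdim v w h1 h2
      · rw [add_comm v w]; exact two hdim w v h2 h1
    · have hne : v ≠ w := by
        rintro rfl
        rw [hvw, segment_same, dim, vectorSpan_singleton, finrank_bot] at hdim
        omega
      rw [hvw] at h0 ⊢
      rw [tipSum_segment hne h0, tipSum_segment hne h0, two_smul]
  · have hno : ∀ ε : ℝ, ε ≠ 0 → tipSum ε P.1 = 0 := fun ε hε =>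
      tipSum_eq_zero fun x hx => h (exists_isEValue_of_isTip P hε hx)
    rw [eVector, dif_neg h, hno 1 one_ne_zero, hno (-1) (by norm_num), add_zero]

theorem eVector_isCutAdditive : IsCutAdditive fun P : PolyO 2 => eVector P.1 := by
  intro a P ha
  have h1 := tipSum_isCutAdditive one_ne_zero a P ha
  have h2 := tipSum_isCutAdditive (ε := -1) (by norm_num) a P ha
  simp only [eVector_eq_tipSum]
  have := congrArg₂ (· + ·) h1 h2
  dsimp only at this
  convert this using 1 <;> abel

theorem eVector_tri {v w : E 2} (h : 0 < cross v w) : eVector (tri v w).1 = v + w := by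
  have hv0 : v ≠ 0 := by rintro rfl; simp at h
  have hw0 : w ≠ 0 := by rintro rfl; simp at h
  have hdim := dim_eq_two_of_cross (tri v w).2.2 (left_mem_tri v w) (right_mem_tri v w) h.ne'
  have hv : IsTip 1 (tri v w).1 v := by
    refine ⟨hv0, left_mem_tri v w, fun t ht => ?_, fun p hp => ?_⟩
    · have := ((mem_tri_iff h).1 ht).2.2
      rw [cross_smul_left, cross_smul_right, cross_self, mul_zero, add_zero] at this
      exact le_of_mul_le_mul_right (by rwa [one_mul]) h
    · rw [one_mul]; exact ((mem_tri_iff h).1 hp).2.1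
  have hw : IsTip (-1) (tri v w).1 w := by
    refine ⟨hw0, right_mem_tri v w, fun t ht => ?_, fun p hp => ?_⟩
    · have := ((mem_tri_iff h).1 ht).2.2
      rw [cross_smul_left, cross_smul_right, cross_self, mul_zero, zero_add] at this
      exact le_of_mul_le_mul_right (by rwa [one_mul]) h
    · rw [cross_swap]; linarith [((mem_tri_iff h).1 hp).1]
  rw [eVector_eq_tipSum, tipSum_eq hv fun x hx => hv.unique one_ne_zero (tri v w).2.2 hdim hx,
    tipSum_eq hw fun x hx => hw.unique (by norm_num) (tri v w).2.2 hdim hx]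

theorem tri_zero_right (v : E 2) : (tri v 0).1 = segment ℝ 0 v := by
  change convexHull ℝ {0, v, 0} = _
  rw [← convexHull_pair]
  congr 1
  ext x
  simp only [Set.mem_insert_iff, Set.mem_singleton_iff]
  tauto

theorem eVector_tri_zero (v : E 2) : eVector (tri v 0).1 = (2 : ℝ) • v := by
  rw [eVector_eq_tipSum]
  rcases eq_or_ne v 0 with rfl | hv
  · have : ∀ ε : ℝ, tipSum ε (tri 0 0).1 = 0 := fun ε => tipSum_eq_zero fun x hx => by
      have := hx.2.1
      rw [tri_zero_right, segment_same] at this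
      exact hx.1 this
    rw [this, this, add_zero, smul_zero]
  · rw [tri_zero_right, tipSum_segment hv.symm (left_mem_segment ℝ 0 v),
      tipSum_segment hv.symm (left_mem_segment ℝ 0 v), zero_add, two_smul]

/-! ### Contravariance -/

/-- The inverse transpose of a `2 × 2` matrix of determinant one is its conjugate by the quarter
turn. -/
theorem act_transpose_inv_quarter (φ : Matrix.SpecialLinearGroup (Fin 2) ℝ) (x : E 2) :
    act (((φ : Matrix (Fin 2) (Fin 2) ℝ)⁻¹).transpose) (quarter x)
      = quarter (act (φ : Matrix (Fin 2) (Fin 2) ℝ) x) := by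
  refine ext_coord ?_ ?_
  · simp [act_apply_zero, act_apply_one, Matrix.inv_def, Matrix.adjugate_fin_two]
  · simp [act_apply_zero, act_apply_one, Matrix.inv_def, Matrix.adjugate_fin_two]; ring

theorem cross_act (φ : Matrix.SpecialLinearGroup (Fin 2) ℝ) (v w : E 2) :
    cross (act (φ : Matrix (Fin 2) (Fin 2) ℝ) v) (act (φ : Matrix (Fin 2) (Fin 2) ℝ) w)
      = cross v w := by
  have h := φ.det_coe
  rw [Matrix.det_fin_two] at h
  simp only [cross, act_apply_zero, act_apply_one]
  linear_combination (v 0 * w 1 - v 1 * w 0) * h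

theorem map_half (φ : Matrix.SpecialLinearGroup (Fin 2) ℝ) (P : PolyO 2) (a : E 2) :
    (P.half a).map φ = (P.map φ).half (act (φ : Matrix (Fin 2) (Fin 2) ℝ) a) := by
  apply PolyO.ext
  change act _ '' (P.1 ∩ {x | 0 ≤ cross a x}) = (act _ '' P.1) ∩ {x | 0 ≤ cross _ x}
  ext y
  constructor
  · rintro ⟨x, ⟨hx, hxa⟩, rfl⟩
    exact ⟨⟨x, hx, rfl⟩, by rw [Set.mem_ofPred_eq, cross_act]; exact hxa⟩
  · rintro ⟨⟨x, hx, rfl⟩, hxa⟩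
    rw [Set.mem_ofPred_eq, cross_act] at hxa
    exact ⟨x, ⟨hx, hxa⟩, rfl⟩

/-- Special linear maps carry half planes to half planes, so the defect of contravariance is cut
additive and need only vanish on triangles and segments. -/
theorem isSLContravariant_of_tri {Z : PolyO 2 → E 2} (hZ : IsCutAdditive Z) {α β : ℝ → ℝ} {c : ℝ}
    (h2 : ∀ v w : E 2, 0 < cross v w →
      Z (tri v w) = quarter (α (cross v w) • v + β (cross v w) • w))
    (h1 : ∀ v : E 2, Z (tri v 0) = quarter (c • v)) : IsSLContravariant Z := by
  intro φ P
  rw [← sub_eq_zero]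
  refine IsCutAdditive.eq_zero (F := fun P => Z (P.map φ)
    - act (((φ : Matrix (Fin 2) (Fin 2) ℝ)⁻¹).transpose) (Z P)) ?_ ?_ ?_ P
  · intro a P ha
    have ha' : act (φ : Matrix (Fin 2) (Fin 2) ℝ) a ≠ 0 := by
      intro h
      have := cross_quarter_self_pos ha
      rw [← cross_act φ, h, cross_zero_left] at this
      exact lt_irrefl _ this
    have e1 := hZ _ (P.map φ) ha'
    have e2 := congrArg (act (((φ : Matrix (Fin 2) (Fin 2) ℝ)⁻¹).transpose)) (hZ a P ha)
    rw [map_add, map_add] at e2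
    simp only [map_half, map_neg]
    have := congrArg₂ (· - ·) e1 e2
    convert this using 1 <;> abel
  · intro v w hvw
    simp only [map_tri]
    rw [h2 _ _ hvw, h2 _ _ (by rwa [cross_act]), act_transpose_inv_quarter, cross_act]
    simp only [map_add, map_smul, sub_self]
  · intro v
    simp only [map_tri, map_zero]
    rw [h1, h1, act_transpose_inv_quarter]
    simp only [map_smul, sub_self]

/-! ### The canonical valuations -/

/-- The canonical form of an `SL(2)` contravariant valuation. -/
def canonical (c₁ c₂ : ℝ) (ζ : ℝ≥0 → ℝ) (P : PolyO 2) : E 2 :=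
  facetVector ζ P.1 + c₁ • rot (Real.pi / 2) (momentVector P.1)
    + c₂ • rot (Real.pi / 2) (eVector P.1)

theorem canonical_isCutAdditive (c₁ c₂ : ℝ) {ζ : ℝ≥0 → ℝ} (hζ : IsCauchySolution ζ) :
    IsCutAdditive (canonical c₁ c₂ ζ) := by
  intro a P ha
  have e1 := facetVector_isCutAdditive hζ a P ha
  have e2 := congrArg (fun x => c₁ • rot (Real.pi / 2) x)
    (momentVector_isValuation.isCutAdditive a P ha)
  have e3 := congrArg (fun x => c₂ • rot (Real.pi / 2) x) (eVector_isCutAdditive a P ha)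
  simp only [map_add, smul_add] at e1 e2 e3
  have := congrArg₂ (· + ·) (congrArg₂ (· + ·) e1 e2) e3
  simp only [canonical] at this ⊢
  convert this using 1 <;> abel

theorem canonical_tri (c₁ c₂ : ℝ) {ζ : ℝ≥0 → ℝ} (hζ : IsCauchySolution ζ) {v w : E 2}
    (h : 0 < cross v w) : canonical c₁ c₂ ζ (tri v w) = quarter
      ((c₁ * stdMoment * cross v w + ζ ((cross v w).toNNReal * stdArea) / cross v w + c₂) • v
      + (c₁ * stdMoment * cross v w - ζ ((cross v w).toNNReal * stdArea) / cross v w + c₂) • w) := by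
  rw [canonical, facetVector_tri hζ.map_zero h, momentVector_tri h, eVector_tri h, rot_eq_quarter,
    ← map_smul, ← map_smul, ← map_smul, ← map_add, ← map_add]
  congr 1
  module

theorem canonical_tri_zero (c₁ c₂ : ℝ) {ζ : ℝ≥0 → ℝ} (hζ : IsCauchySolution ζ) (v : E 2) :
    canonical c₁ c₂ ζ (tri v 0) = quarter ((2 * c₂) • v) := by
  rw [canonical, facetVector_tri_zero hζ.map_zero, momentVector_tri_zero, eVector_tri_zero,
    rot_eq_quarter, map_zero, smul_zero, zero_add, zero_add, ← map_smul, smul_smul, mul_comm]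

theorem canonical_isSLContravariant (c₁ c₂ : ℝ) {ζ : ℝ≥0 → ℝ} (hζ : IsCauchySolution ζ) :
    IsSLContravariant (canonical c₁ c₂ ζ) :=
  isSLContravariant_of_tri (canonical_isCutAdditive c₁ c₂ hζ)
    (α := fun D => c₁ * stdMoment * D + ζ (D.toNNReal * stdArea) / D + c₂)
    (β := fun D => c₁ * stdMoment * D - ζ (D.toNNReal * stdArea) / D + c₂)
    (fun _ _ h => canonical_tri c₁ c₂ hζ h) (fun v => canonical_tri_zero c₁ c₂ hζ v)

/-! ### Classification -/

theorem quarter_quarter (x : E 2) : quarter (quarter x) = -x :=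
  ext_coord (by simp) (by simp)

theorem quarter_injective : Function.Injective quarter := by
  intro x y h
  have := congrArg quarter h
  rwa [quarter_quarter, quarter_quarter, neg_inj] at this

theorem exists_eq_quarter (x : E 2) : ∃ y, x = quarter y :=
  ⟨-quarter x, by rw [map_neg, quarter_quarter, neg_neg]⟩

/-- Contravariance for the special linear map with columns `v` and `w`. -/
theorem IsSLContravariant.frame {Z : PolyO 2 → E 2} (hZ : IsSLContravariant Z) {a b v w y : E 2}
    (h : cross v w = 1) (hy : Z (tri a b) = quarter y) :
    Z (tri (a 0 • v + a 1 • w) (b 0 • v + b 1 • w)) = quarter (y 0 • v + y 1 • w) := by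
  obtain ⟨φ, hφ⟩ : ∃ φ : Matrix.SpecialLinearGroup (Fin 2) ℝ,
      (φ : Matrix (Fin 2) (Fin 2) ℝ) = PlanarValuation.frame v w :=
    ⟨⟨PlanarValuation.frame v w, by rw [det_frame, h]⟩, rfl⟩
  have := hZ φ (tri a b)
  rw [map_tri, hy, act_transpose_inv_quarter, hφ] at this
  simpa only [act_frame] using this

/-- `SL(2)` is transitive on nonzero vectors, and the shears fixing the first basis vector force the
value to be parallel to it after undoing the rotation. -/
theorem IsSLContravariant.exists_segment {Z : PolyO 2 → E 2} (hZ : IsSLContravariant Z) :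
    ∃ c : ℝ, ∀ v : E 2, Z (tri v 0) = quarter (c • v) := by
  obtain ⟨y, hy⟩ := exists_eq_quarter (Z (tri !₂[1, 0] 0))
  have key : ∀ v w : E 2, cross v w = 1 → Z (tri v 0) = quarter (y 0 • v + y 1 • w) := by
    intro v w h
    have := hZ.frame h hy
    simpa using this
  have hy1 : y 1 = 0 := by
    have h1 := key !₂[1, 0] !₂[1, 1] (by simp [cross])
    rw [hy] at h1
    have := congrArg (fun x : E 2 => x 0) (quarter_injective h1)
    simpa using this
  refine ⟨y 0, fun v => ?_⟩
  rcases eq_or_ne v 0 with rfl | hv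
  · obtain ⟨z, hz⟩ := exists_eq_quarter (Z (tri 0 0))
    -- The map `-1` fixes the origin, so the value there equals its own negative.
    have h1 := hZ.frame (v := -!₂[1, 0]) (w := -!₂[0, 1]) (by simp [cross]) hz
    simp only [PiLp.zero_apply, zero_smul, add_zero] at h1
    rw [hz] at h1
    have e := quarter_injective h1
    have e0 := congrArg (fun x : E 2 => x 0) e
    have e1 := congrArg (fun x : E 2 => x 1) e
    simp at e0 e1
    have : z = 0 := ext_coord (by simp; linarith) (by simp; linarith)
    rw [hz, this, smul_zero]
  · have hpos := cross_quarter_self_pos hv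
    have := key v ((cross v (quarter v))⁻¹ • quarter v) (by
      rw [cross_smul_right, inv_mul_cancel₀ hpos.ne'])
    rw [this, hy1, zero_smul, add_zero]

theorem IsSLContravariant.exists_triangle {Z : PolyO 2 → E 2} (hZ : IsSLContravariant Z) :
    ∃ α β : ℝ → ℝ, ∀ v w : E 2, 0 < cross v w →
      Z (tri v w) = quarter (α (cross v w) • v + β (cross v w) • w) := by
  choose y hy using fun D : ℝ => exists_eq_quarter (Z (tri !₂[1, 0] !₂[0, D]))
  -- The model triangle has second vertex `D` times the second basis vector, hence the division by
  -- `D`.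
  refine ⟨fun D => y D 0, fun D => y D 1 / D, fun v w h => ?_⟩
  have := hZ.frame (v := v) (w := (cross v w)⁻¹ • w)
    (by rw [cross_smul_right, inv_mul_cancel₀ h.ne']) (hy (cross v w))
  simp only [smul_smul] at this
  simpa [div_eq_mul_inv, mul_inv_cancel₀ h.ne'] using this

theorem half_tri {v w : E 2} (h : 0 < cross v w) {s t : ℝ} (hs : 0 < s) (ht : 0 < t)
    (hst : s + t = 1) :
    (tri v w).half (s • v + t • w) = tri (s • v + t • w) w ∧
    (tri v w).half (-(s • v + t • w)) = tri v (s • v + t • w) ∧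
    ((tri v w).half (s • v + t • w)).half (-(s • v + t • w)) = tri (s • v + t • w) 0 := by
  have e1 : cross (s • v + t • w) w = s * cross v w := by
    simp [cross_add_left, cross_smul_left]
  have e2 : cross v (s • v + t • w) = t * cross v w := by
    simp [cross_add_right, cross_smul_right]
  have e3 : ∀ p, cross (s • v + t • w) p = s * cross v p - t * cross p w := by
    intro p
    rw [cross_add_left, cross_smul_left, cross_smul_left, cross_swap w p]; ring
  have e4 : ∀ p, cross p (s • v + t • w) = -(s * cross v p - t * cross p w) := by
    intro p
    rw [cross_swap, e3]
  have hw : 0 < cross (s • v + t • w) w := by rw [e1]; positivity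
  have hv : 0 < cross v (s • v + t • w) := by rw [e2]; positivity
  have hs' : t = 1 - s := by linarith
  refine ⟨PolyO.ext ?_, PolyO.ext ?_, PolyO.ext ?_⟩
  · ext p
    rw [PolyO.mem_half, mem_tri_iff h, mem_tri_iff hw, e3, e1]
    constructor
    · rintro ⟨⟨h1, h2, h3⟩, h4⟩
      exact ⟨h1, h4, by subst hs'; nlinarith⟩
    · rintro ⟨h1, h2, h3⟩
      refine ⟨⟨h1, ?_, ?_⟩, h2⟩
      · have : 0 ≤ s * cross v p := by nlinarith
        exact nonneg_of_mul_nonneg_right this hs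
      · refine le_of_mul_le_mul_left ?_ hs
        subst hs'; nlinarith
  · ext p
    rw [PolyO.mem_half, mem_tri_iff h, mem_tri_iff hv, cross_neg_left, e3, e4, e2]
    constructor
    · rintro ⟨⟨h1, h2, h3⟩, h4⟩
      exact ⟨h4, h2, by subst hs'; nlinarith⟩
    · rintro ⟨h1, h2, h3⟩
      refine ⟨⟨?_, h2, ?_⟩, h1⟩
      · have : 0 ≤ t * cross p w := by nlinarith
        exact nonneg_of_mul_nonneg_right this ht
      · refine le_of_mul_le_mul_left ?_ ht
        have hs'' : s = 1 - t := by linarith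
        subst hs''; nlinarith
  · ext p
    rw [PolyO.mem_half, PolyO.mem_half, mem_tri, mem_tri, cross_neg_left]
    constructor
    · rintro ⟨⟨⟨a, b, ha, hb, hab, rfl⟩, h1⟩, h2⟩
      have e : s * b - t * a = 0 := by
        have e : cross (s • v + t • w) (a • v + b • w) = (s * b - t * a) * cross v w := by
          rw [e3]; simp [cross_add_left, cross_add_right, cross_smul_left, cross_smul_right]; ring
        have : (s * b - t * a) * cross v w = 0 := by linarith
        exact (mul_eq_zero.1 this).resolve_right h.ne'
      refine ⟨a + b, 0, by positivity, le_rfl, by linarith, ?_⟩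
      have ea : a = (a + b) * s := by subst hs'; linarith
      have eb : b = (a + b) * t := by rw [hs']; linarith
      rw [smul_zero, add_zero, smul_add, smul_smul, smul_smul, ← ea, ← eb]
    · rintro ⟨a, b, ha, hb, hab, rfl⟩
      have e : cross (s • v + t • w) (a • (s • v + t • w) + b • 0) = 0 := by
        rw [smul_zero, add_zero, cross_smul_right, cross_self, mul_zero]
      refine ⟨⟨⟨a * s, a * t, by positivity, by positivity, ?_, by module⟩, e.ge⟩, by rw [e, neg_zero]⟩
      rw [← mul_add, hst]; linarith

/-- The functional equation obtained by cutting a triangle, and its solutions. -/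
theorem exists_cauchy_of_triangle {α β : ℝ → ℝ} {c : ℝ}
    (h : ∀ p q : ℝ, 0 < p → 0 < q →
      α (p + q) * (p + q) + c * q = α p * (p + q) + (β p + α q) * q) :
    ∃ (k : ℝ) (ζ : ℝ≥0 → ℝ), IsCauchySolution ζ ∧ ∀ p : ℝ, 0 < p →
      α p = k * p + ζ p.toNNReal / p + c / 2 ∧ β p = k * p - ζ p.toNNReal / p + c / 2 := by
  -- The equations for `(p, 1)` and `(1, p)` share their term in `α (p + 1)`; subtracting them shows
  -- that `α + β - c` is linear.
  set K := α 1 + β 1 - c with hK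
  have hS : ∀ p, 0 < p → α p + β p - c = K * p := by
    intro p hp
    have h1 := h p 1 hp one_pos
    have h2 := h 1 p one_pos hp
    rw [add_comm 1 p] at h2
    rw [hK]
    linarith
  -- `ζ` is obtained by solving the claimed formula for `α`. The factor `x` gives `ζ 0 = 0` whatever
  -- `α 0` is.
  refine ⟨K / 2, fun x => x * (α x - c / 2) - K / 2 * x ^ 2, fun x y => ?_, fun p hp => ?_⟩
  · rcases eq_or_ne x 0 with rfl | hx
    · simp
    rcases eq_or_ne y 0 with rfl | hy
    · simp
    have hx' : (0 : ℝ) < x := NNReal.coe_pos.2 (pos_iff_ne_zero.2 hx)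
    have hy' : (0 : ℝ) < y := NNReal.coe_pos.2 (pos_iff_ne_zero.2 hy)
    push_cast
    linear_combination h x y hx' hy' + (y : ℝ) * hS x hx'
  · have hb : β p = K * p - α p + c := by linarith [hS p hp]
    simp only [hb, Real.coe_toNNReal p hp.le]
    constructor <;> field_simp <;> ring

theorem exists_eq_canonical {Z : PolyO 2 → E 2} (hV : IsValuation Z) (hZ : IsSLContravariant Z) :
    ∃ (c₁ c₂ : ℝ) (ζ : ℝ≥0 → ℝ), IsCauchySolution ζ ∧ ∀ P, Z P = canonical c₁ c₂ ζ P := by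
  obtain ⟨c, hc⟩ := hZ.exists_segment
  obtain ⟨α, β, hαβ⟩ := hZ.exists_triangle
  have hcut : ∀ p q : ℝ, 0 < p → 0 < q →
      α (p + q) * (p + q) + c * q = α p * (p + q) + (β p + α q) * q := by
    intro p q hp hq
    have hpq : 0 < p + q := by positivity
    set v : E 2 := !₂[1, 0] with hv
    set w : E 2 := !₂[0, p + q] with hw
    have hvw : cross v w = p + q := by simp [hv, hw, cross]
    -- The weights are chosen so that the pieces have determinants `p` and `q`.
    obtain ⟨f1, f2, f3⟩ := half_tri (v := v) (w := w) (by rw [hvw]; exact hpq)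
      (s := q / (p + q)) (t := p / (p + q)) (by positivity) (by positivity) (by field_simp; ring)
    set x := (q / (p + q)) • v + (p / (p + q)) • w with hx
    have hvx : cross v x = p := by
      rw [hx, cross_add_right, cross_smul_right, cross_smul_right, hvw, cross_self]; field_simp; ring
    have hxw : cross x w = q := by
      rw [hx, cross_add_left, cross_smul_left, cross_smul_left, hvw, cross_self]; field_simp; ring
    have hx0 : x ≠ 0 := by
      rintro h0
      rw [h0, cross_zero_right] at hvx
      exact hp.ne hvx
    have := hV.isCutAdditive x (tri v w) hx0
    rw [f3, f1, f2, hαβ v w (by rwa [hvw]), hαβ x w (by rwa [hxw]), hαβ v x (by rwa [hvx]), hc,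
      hvw, hvx, hxw, ← map_add, ← map_add] at this
    -- The first coordinate alone, that is the coefficient of `v`, already gives the whole
    -- functional equation.
    have e := congrArg (fun z : E 2 => z 0) (quarter_injective this)
    simp only [hx, hv, hw, PiLp.add_apply, PiLp.smul_apply, smul_eq_mul] at e
    simp at e
    field_simp at e
    linarith
  obtain ⟨k, ζ, hζ, hk⟩ := exists_cauchy_of_triangle hcut
  have hA := stdArea_pos
  have hζ' : IsCauchySolution fun x => ζ (x / stdArea) := by
    intro x y
    simp only [add_div]
    exact hζ _ _
  -- The rescalings undo the factors `stdMoment` and `stdArea` in `canonical_tri`; `c / 2` matches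
  -- the value `2 c₂` on segments.
  refine ⟨k / stdMoment, c / 2, fun x => ζ (x / stdArea), hζ', fun P => ?_⟩
  rw [← sub_eq_zero]
  refine IsCutAdditive.eq_zero (F := fun P => Z P - canonical (k / stdMoment) (c / 2)
    (fun x => ζ (x / stdArea)) P) ?_ ?_ ?_ P
  · intro a P ha
    have := congrArg₂ (· - ·) (hV.isCutAdditive a P ha)
      (canonical_isCutAdditive (k / stdMoment) (c / 2) hζ' a P ha)
    dsimp only at this ⊢
    convert this using 1 <;> abel
  · intro v w h
    obtain ⟨h1, h2⟩ := hk _ h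
    rw [hαβ v w h, canonical_tri _ _ hζ' h, h1, h2, mul_div_cancel_right₀ _ hA.ne',
      div_mul_cancel₀ _ stdMoment_pos.ne', sub_self]
  · intro v
    rw [hc, canonical_tri_zero _ _ hζ', mul_div_cancel₀ _ two_ne_zero, sub_self]

end PlanarValuation

end

open PlanarValuation in
/-- Classification of the `SL(2)` contravariant vector valuations on planar polytopes containing
the origin. -/
theorem theorem1p2 (Z : PolyO 2 → E 2) :
    (IsValuation Z ∧ IsSLContravariant Z) ↔
      ∃ (c₁ c₂ : ℝ) (ζ : ℝ≥0 → ℝ), IsCauchySolution ζ ∧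
        ∀ P : PolyO 2, Z P = facetVector ζ P.1 + c₁ • rot (Real.pi / 2) (momentVector P.1)
          + c₂ • rot (Real.pi / 2) (eVector P.1) := by
  constructor
  · rintro ⟨hV, hZ⟩
    exact exists_eq_canonical hV hZ
  · rintro ⟨c₁, c₂, ζ, hζ, hZ⟩
    obtain rfl : Z = canonical c₁ c₂ ζ := funext hZ
    exact ⟨(canonical_isCutAdditive c₁ c₂ hζ).isValuation, canonical_isSLContravariant c₁ c₂ hζ⟩
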